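/- Let $F$ be a field of characteristic different from $2,3,5$, let $D\in \mathrm{Der}_{\mathbb Z}(F,F)$, and write $D\log x=D(x)/x$ for $x\in F^\times$ and $F^{\bullet\bullet}=F\setminus\{0,1\}$. Let $V$ be a three-dimensional $F$-vector space, $\omega$ a nonzero alternating $3$-form on $V$, and $\Delta(x,y,z)=\omega(x,y,z)$. **Grassmannian complex.** $C_m(3)$ is the free abelian group on the $GL(V)$-orbits of $m$-tuples $(l_0,\dots,l_{m-1})$ of vectors of $V$ in generic position (any three or fewer of them are linearly independent), and $d(l_0,\dots,l_m)=\sum_{i=0}^m(-1)^i(l_0,\dots,\hat l_i,\dots,l_m)$. **Infinitesimal complex.** All tensor products are over $\mathbb Z$. - $\mathcal B_2(F)$ is the quotient of $\mathbb Z[F^{\bullet\bullet}]$ by the subgroup generated by $\sum_{i=0}^4(-1)^i[r(x_0,\dots,\hat x_i,\dots,x_4)]$ for pairwise distinct $x_0,\dots,x_4\in\mathbb P^1(F)$, where $r(x_0,x_1,x_2,x_3)=\frac{(x_0-x_3)(x_1-x_2)}{(x_0-x_2)(x_1-x_3)}$; $[a]_2$ is the class of $[a]$. - For $a\in F^{\bullet\bullet}$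 let $[\![a]\!]^D=\frac{D(a)}{a(1-a)}[a]$ in the $F$-vector space $F[F^{\bullet\bullet}]$ with basis $F^{\bullet\bullet}$. $\beta^D_2(F)$ is the $F$-subspace spanned by the classes $[\![a]\!]^D_2$ of the $[\![a]\!]^D$ in the quotient of $F[F^{\bullet\bullet}]$ by the span of the elements $[\![a]\!]^D-[\![b]\!]^D+[\![\frac ba]\!]^D-[\![\frac{1-b}{1-a}]\!]^D+[\![\frac{1-b^{-1}}{1-a^{-1}}]\!]^D$, $a\ne b$ in $F^{\bullet\bullet}$. - $\beta^D_3(F)$ is the quotient of $F[F^{\bullet\bullet}]$ by the kernel of the $F$-linear map to $(\beta^D_2(F)\otimes F^\times)\oplus(F\otimes\mathcal B_2(F))$ that sends $[\![a]\!]^D$ to $[\![a]\!]^D_2\otimes a+D\log(a)\otimes[a]_2$ (and $[a]$ to $0$ when $D(a)=0$); $[\![a]\!]_3^D$ is the class of $[\![a]\!]^D$, and $[\![1]\!]^D_3:=0$. - The differentials are $\partial[\![a]\!]^D_3=[\![a]\!]^D_2\otimes a+D\log(a)\otimes[a]_2$ and $$\partial([\![a]\!]^D_2\otimes b+x\otimes[y]_2)=D\log(1-a)\otimes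 a\wedge b-D\log(a)\otimes(1-a)\wedge b+x\otimes(1-y)\wedge y .$$ **The maps.** Put $r(x|y_0,y_1,y_2,y_3)=\frac{\Delta(x,y_0,y_3)\Delta(x,y_1,y_2)}{\Delta(x,y_0,y_2)\Delta(x,y_1,y_3)}$. With $\Delta_i=\Delta(l_0,\dots,\hat l_i,\dots,l_3)$ (indices mod $4$), $\Delta(\hat l_i,\hat l_j)$ the determinant of the three vectors left from $l_0,\dots,l_4$ after omitting $l_i,l_j$, and $P_i=\prod_{j\ne i}\Delta(\hat l_i,\hat l_j)$, let $$\tau^3_0(l_0,\dots,l_3)=\sum_{i=0}^3(-1)^i\,D\log\Delta_i\otimes\frac{\Delta_{i+1}}{\Delta_{i+2}}\wedge\frac{\Delta_{i+3}}{\Delta_{i+2}},$$ $$\tau^3_1(l_0,\dots,l_4)=-\frac13\sum_{i=0}^4(-1)^i\Big([\![r(l_i|l_0,\dots,\hat l_i,\dots,l_4)]\!]^D_2\otimes P_i+D\log P_i\otimes[r(l_i|l_0,\dots,\hat l_i,\dots,l_4)]_2\Big),$$ $$\tau^3_2(l_0,\dots,l_5)=-\frac1{90}\sum_{\sigma\in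 S_6}\mathrm{sgn}(\sigma)\left[\!\!\left[\frac{\Delta(l_{\sigma0},l_{\sigma1},l_{\sigma3})\,\Delta(l_{\sigma1},l_{\sigma2},l_{\sigma4})\,\Delta(l_{\sigma2},l_{\sigma0},l_{\sigma5})}{\Delta(l_{\sigma0},l_{\sigma1},l_{\sigma4})\,\Delta(l_{\sigma1},l_{\sigma2},l_{\sigma5})\,\Delta(l_{\sigma2},l_{\sigma0},l_{\sigma3})}\right]\!\!\right]^D_3 .$$ These are well defined on configurations. **Claim.** In the diagram with rows $C_6(3)\xrightarrow{d}C_5(3)\xrightarrow{d}C_4(3)$ and $\beta^D_3(F)\xrightarrow{\partial}(\beta^D_2(F)\otimes F^\times)\oplus(F\otimes\mathcal B_2(F))\xrightarrow{\partial}F\otimes\bigwedge^2F^\times$ and vertical maps $\tau^3_2,\tau^3_1,\tau^3_0$, both rows are complexes ($d\circ d=0$, $\partial\circ\partial=0$) and both squares commute: $$\partial\circ\tau^3_2=\tau^3_1\circ d,\qquad \partial\circ\tau^3_1=\tau^3_0\circ d .$$ So $(\tau^3_2,\tau^3_1,\tau^3_0)$ is a morphism of complexes. -/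

import Mathlib

open scoped TensorProduct

noncomputable section

namespace WeightThree

/-! ## Symbols over a field -/

section Symbols

variable {F : Type*} [Field F]

/-- The doubly punctured affine line `F ∖ {0, 1}`. -/
abbrev Punctured (F : Type*) [Field F] : Type _ := {a : F // a ≠ 0 ∧ a ≠ 1}

/-- The multiplicative group of `F`, written additively (a `ℤ`-module). -/
abbrev MulGroup (F : Type*) [Field F] : Type _ := Additive Fˣ

/-- A nonzero element of `F` as an element of the multiplicative group
(the value at `0`, which is never used, is the neutral element). -/
def unitOf (x : F) : MulGroup F :=
  open Classical in if h : x = 0 then 0 else Additive.ofMul (Units.mk0 x h)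

/-- The logarithmic derivative `D(x) / x`. -/
def dlog (D : Derivation ℤ F F) (x : F) : F := D x / x

/-- The second exterior power of the multiplicative group, over `ℤ`. -/
abbrev Wedge2 (F : Type*) [Field F] : Type _ := ⋀[ℤ]^2 (MulGroup F)

/-- The element `a ∧ b`. -/
def wedge (a b : MulGroup F) : Wedge2 F := exteriorPower.ιMulti ℤ 2 ![a, b]

/-! ### The group `B₂(F)` -/

/-- The generator `[x]` of the free abelian group on `F ∖ {0, 1}`; `[x] = 0` for `x = 0, 1`. -/
def intSymb (x : F) : FreeAbelianGroup (Punctured F) :=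
  open Classical in if h : x ≠ 0 ∧ x ≠ 1 then FreeAbelianGroup.of ⟨x, h⟩ else 0

/-- The `2 × 2` determinant. -/
def det2 (u v : Fin 2 → F) : F := u 0 * v 1 - u 1 * v 0

/-- The cross-ratio of four points of the projective line given by homogeneous coordinates. -/
def crossRatio (p : Fin 4 → Fin 2 → F) : F :=
  (det2 (p 0) (p 3) * det2 (p 1) (p 2)) / (det2 (p 0) (p 2) * det2 (p 1) (p 3))

/-- The subgroup generated by the five-term relations of the cross-ratio, one for each
quintuple of pairwise distinct points of the projective line. -/
def R2 (F : Type*) [Field F] : AddSubgroup (FreeAbelianGroup (Punctured F)) :=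
  AddSubgroup.closure
    {z | ∃ p : Fin 5 → Fin 2 → F, (∀ i j, i ≠ j → det2 (p i) (p j) ≠ 0) ∧
      z = ∑ i : Fin 5, (-1 : ℤ) ^ (i : ℕ) • intSymb (crossRatio fun k => p (i.succAbove k))}

/-- The group `B₂(F)`. -/
abbrev B2 (F : Type*) [Field F] : Type _ := FreeAbelianGroup (Punctured F) ⧸ R2 F

/-- The class `[x]₂` in `B₂(F)`. -/
def symbB2 (x : F) : B2 F := QuotientAddGroup.mk (intSymb x)

/-! ### The vector spaces `β₂ᴰ(F)` and `β₃ᴰ(F)` -/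

/-- The element `⟦x⟧ᴰ = D(x) / (x (1 - x)) [x]` of the `F`-vector space with basis
`F ∖ {0, 1}`; it is `0` for `x = 0, 1`. -/
def symb (D : Derivation ℤ F F) (x : F) : Punctured F →₀ F :=
  open Classical in
  if h : x ≠ 0 ∧ x ≠ 1 then Finsupp.single ⟨x, h⟩ (D x / (x * (1 - x))) else 0

/-- The subspace spanned by the five-term relations between the elements `⟦x⟧ᴰ`. -/
def fiveTerm (D : Derivation ℤ F F) : Submodule F (Punctured F →₀ F) :=
  Submodule.span F
    {z | ∃ a b : F, a ≠ 0 ∧ a ≠ 1 ∧ b ≠ 0 ∧ b ≠ 1 ∧ a ≠ b ∧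
      z = symb D a - symb D b + symb D (b / a) - symb D ((1 - b) / (1 - a))
        + symb D ((1 - b⁻¹) / (1 - a⁻¹))}

/-- `β₂ᴰ(F)`: the subspace of `F[F ∖ {0, 1}] / (five-term relations)` generated by
the classes of the elements `⟦x⟧ᴰ`. -/
abbrev beta2Sub (D : Derivation ℤ F F) : Submodule F ((Punctured F →₀ F) ⧸ fiveTerm D) :=
  Submodule.span F (Set.range fun x : F => (fiveTerm D).mkQ (symb D x))

abbrev Beta2 (D : Derivation ℤ F F) : Type _ := ↥(beta2Sub D)

/-- The class `⟦x⟧₂ᴰ` in `β₂ᴰ(F)`. -/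
def symb2 (D : Derivation ℤ F F) (x : F) : Beta2 D :=
  ⟨(fiveTerm D).mkQ (symb D x), Submodule.subset_span ⟨x, rfl⟩⟩

/-- The middle term `(β₂ᴰ(F) ⊗ F^×) ⊕ (F ⊗ B₂(F))` of the infinitesimal complex. -/
abbrev Mid (D : Derivation ℤ F F) : Type _ :=
  (Beta2 D ⊗[ℤ] MulGroup F) × (F ⊗[ℤ] B2 F)

/-- The `F`-linear map `F[F ∖ {0, 1}] → (β₂ᴰ(F) ⊗ F^×) ⊕ (F ⊗ B₂(F))` with
`⟦a⟧ᴰ ↦ ⟦a⟧₂ᴰ ⊗ a + (D(a) / a) ⊗ [a]₂` (see `bdry3Pre_symb`). A generator `[a]` with `D(a) = 0` is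
not a multiple of `⟦a⟧ᴰ = 0` and is sent to `0`, so that it dies in `β₃ᴰ(F)`: this quotient is
spanned by the classes of the `⟦a⟧ᴰ`. -/
def bdry3Pre (D : Derivation ℤ F F) : (Punctured F →₀ F) →ₗ[F] Mid D :=
  Finsupp.linearCombination F fun a : Punctured F =>
    (D a.1 / (a.1 * (1 - a.1)))⁻¹ •
      ((symb2 D a.1 ⊗ₜ[ℤ] unitOf a.1, dlog D a.1 ⊗ₜ[ℤ] symbB2 a.1) : Mid D)

/-- `β₃ᴰ(F)`: the quotient of `F[F ∖ {0, 1}]` by the kernel of `bdry3Pre`. -/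
abbrev Beta3 (D : Derivation ℤ F F) : Type _ :=
  (Punctured F →₀ F) ⧸ LinearMap.ker (bdry3Pre D)

/-- The class `⟦x⟧₃ᴰ` in `β₃ᴰ(F)`. -/
def symb3 (D : Derivation ℤ F F) (x : F) : Beta3 D :=
  (LinearMap.ker (bdry3Pre D)).mkQ (symb D x)

/-- The differential `β₃ᴰ(F) → (β₂ᴰ(F) ⊗ F^×) ⊕ (F ⊗ B₂(F))`. -/
def bdry3 (D : Derivation ℤ F F) : Beta3 D →ₗ[F] Mid D :=
  (LinearMap.ker (bdry3Pre D)).liftQ (bdry3Pre D) le_rfl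

/-! ### Well-definedness of the second differential -/

lemma unitOf_mul {x y : F} (hx : x ≠ 0) (hy : y ≠ 0) :
    unitOf (x * y) = unitOf x + unitOf y := by
  simp only [unitOf, hx, hy, mul_ne_zero hx hy, dif_neg, not_false_eq_true, ← ofMul_mul]
  congr 1
  ext
  simp

lemma unitOf_div {x y : F} (hx : x ≠ 0) (hy : y ≠ 0) :
    unitOf (x / y) = unitOf x - unitOf y := by
  rw [eq_sub_iff_add_eq, ← unitOf_mul (div_ne_zero hx hy) hy, div_mul_cancel₀ _ hy]

lemma dlog_mul (D : Derivation ℤ F F) {x y : F} (hx : x ≠ 0) (hy : y ≠ 0) :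
    dlog D (x * y) = dlog D x + dlog D y := by
  simp only [dlog, Derivation.leibniz, smul_eq_mul]
  field_simp
  ring

lemma dlog_div (D : Derivation ℤ F F) {x y : F} (hx : x ≠ 0) (hy : y ≠ 0) :
    dlog D (x / y) = dlog D x - dlog D y := by
  rw [eq_sub_iff_add_eq, ← dlog_mul D (div_ne_zero hx hy) hy, div_mul_cancel₀ _ hy]

lemma dlog_neg (D : Derivation ℤ F F) (x : F) : dlog D (-x) = dlog D x := by
  simp [dlog]

lemma tmul_unitOf_neg [NeZero (2 : F)] (c : F) {x : F} (hx : x ≠ 0) :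
    c ⊗ₜ[ℤ] unitOf (-x) = c ⊗ₜ[ℤ] unitOf x := by
  have h1 : unitOf (-x) = unitOf (-1) + unitOf x := by
    rw [← unitOf_mul (by simp) hx, neg_one_mul]
  have h2 : (unitOf (-1 : F)) + unitOf (-1 : F) = 0 := by
    rw [← unitOf_mul (by simp) (by simp)]
    simp [unitOf]
  have h3 : c ⊗ₜ[ℤ] unitOf (-1 : F) = 0 := by
    have h4 : c = (2 : ℤ) • (c / 2) := by
      rw [zsmul_eq_mul, Int.cast_ofNat, mul_div_cancel₀ _ (NeZero.ne (2 : F))]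
    rw [h4, TensorProduct.smul_tmul, two_zsmul, h2, TensorProduct.tmul_zero]
  rw [h1, TensorProduct.tmul_add, h3, zero_add]

lemma update_zero_pair (x y z : MulGroup F) : Function.update ![x, y] 0 z = ![z, y] := by
  ext k; fin_cases k <;> rfl

lemma update_one_pair (x y z : MulGroup F) : Function.update ![x, y] 1 z = ![x, z] := by
  ext k; fin_cases k <;> rfl

/-- The bilinear map `(a, b) ↦ a ∧ b`. -/
def wedgeBilin (F : Type*) [Field F] : MulGroup F →ₗ[ℤ] MulGroup F →ₗ[ℤ] Wedge2 F :=
  LinearMap.mk₂ ℤ wedge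
    (fun a a' b => by
      have := (exteriorPower.ιMulti ℤ 2 (M := MulGroup F)).map_update_add ![0, b] 0 a a'
      simpa only [update_zero_pair, wedge] using this)
    (fun c a b => by
      have := (exteriorPower.ιMulti ℤ 2 (M := MulGroup F)).map_update_smul ![0, b] 0 c a
      simpa only [update_zero_pair, wedge] using this)
    (fun a b b' => by
      have := (exteriorPower.ιMulti ℤ 2 (M := MulGroup F)).map_update_add ![a, 0] 1 b b'
      simpa only [update_one_pair, wedge] using this)
    (fun c a b => by
      have := (exteriorPower.ιMulti ℤ 2 (M := MulGroup F)).map_update_smul ![a, 0] 1 c b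
      simpa only [update_one_pair, wedge] using this)

lemma wedgeBilin_apply (a b : MulGroup F) : wedgeBilin F a b = wedge a b := rfl

lemma wedgeBilin_self (a : MulGroup F) : wedgeBilin F a a = 0 :=
  (exteriorPower.ιMulti ℤ 2 (M := MulGroup F)).map_eq_zero_of_eq ![a, a]
    (i := 0) (j := 1) rfl (by decide)

lemma wedgeBilin_swap (a b : MulGroup F) : wedgeBilin F a b = -wedgeBilin F b a := by
  have h := wedgeBilin_self (a + b)
  simp only [map_add, LinearMap.add_apply, wedgeBilin_self] at h
  rw [eq_neg_iff_add_eq_zero, ← h]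
  abel

lemma crossRatio_ne {p : Fin 4 → Fin 2 → F} (hp : ∀ i j, i ≠ j → det2 (p i) (p j) ≠ 0) :
    crossRatio p ≠ 0 ∧ crossRatio p ≠ 1 ∧
      1 - crossRatio p =
        (det2 (p 0) (p 1) * det2 (p 2) (p 3)) / (det2 (p 0) (p 2) * det2 (p 1) (p 3)) := by
  have h02 := hp 0 2 (by decide)
  have h13 := hp 1 3 (by decide)
  have h : 1 - crossRatio p =
      (det2 (p 0) (p 1) * det2 (p 2) (p 3)) / (det2 (p 0) (p 2) * det2 (p 1) (p 3)) := by
    rw [crossRatio, eq_div_iff (mul_ne_zero h02 h13), sub_mul,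
      div_mul_cancel₀ _ (mul_ne_zero h02 h13)]
    simp only [det2]
    ring
  have h0 : crossRatio p ≠ 0 :=
    div_ne_zero (mul_ne_zero (hp 0 3 (by decide)) (hp 1 2 (by decide))) (mul_ne_zero h02 h13)
  refine ⟨h0, fun h1 => ?_, h⟩
  rw [h1, sub_self] at h
  exact div_ne_zero (mul_ne_zero (hp 0 1 (by decide)) (hp 2 3 (by decide)))
    (mul_ne_zero h02 h13) h.symm

/-- The map `[x] ↦ (1 - x) ∧ x` on the free abelian group. -/
def delta2Pre (F : Type*) [Field F] : FreeAbelianGroup (Punctured F) →+ Wedge2 F :=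
  FreeAbelianGroup.lift fun a => wedge (unitOf (1 - a.1)) (unitOf a.1)

lemma delta2Pre_intSymb {x : F} (h0 : x ≠ 0) (h1 : x ≠ 1) :
    delta2Pre F (intSymb x) = wedge (unitOf (1 - x)) (unitOf x) := by
  simp [delta2Pre, intSymb, h0, h1]

lemma delta2Pre_crossRatio {p : Fin 4 → Fin 2 → F}
    (hp : ∀ i j, i ≠ j → det2 (p i) (p j) ≠ 0) :
    delta2Pre F (intSymb (crossRatio p)) =
      wedgeBilin F
        (unitOf (det2 (p 0) (p 1)) + unitOf (det2 (p 2) (p 3))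
          - (unitOf (det2 (p 0) (p 2)) + unitOf (det2 (p 1) (p 3))))
        (unitOf (det2 (p 0) (p 3)) + unitOf (det2 (p 1) (p 2))
          - (unitOf (det2 (p 0) (p 2)) + unitOf (det2 (p 1) (p 3)))) := by
  obtain ⟨h0, h1, h2⟩ := crossRatio_ne hp
  have e01 := hp 0 1 (by decide)
  have e02 := hp 0 2 (by decide)
  have e03 := hp 0 3 (by decide)
  have e12 := hp 1 2 (by decide)
  have e13 := hp 1 3 (by decide)
  have e23 := hp 2 3 (by decide)
  rw [delta2Pre_intSymb h0 h1, h2, crossRatio, wedgeBilin_apply,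
    unitOf_div (mul_ne_zero e01 e23) (mul_ne_zero e02 e13),
    unitOf_div (mul_ne_zero e03 e12) (mul_ne_zero e02 e13),
    unitOf_mul e01 e23, unitOf_mul e02 e13, unitOf_mul e03 e12]

lemma R2_le_ker : R2 F ≤ (delta2Pre F).ker := by
  rw [R2, AddSubgroup.closure_le]
  rintro z ⟨p, hp, rfl⟩
  simp only [SetLike.mem_coe, AddMonoidHom.mem_ker, map_sum, map_zsmul]
  have key : ∀ i : Fin 5, _ := fun i => delta2Pre_crossRatio (p := fun k => p (i.succAbove k))
    (fun a b hab => hp _ _ (fun h => hab (Fin.succAbove_right_injective h)))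
  simp only [key, Fin.sum_univ_five]
  have r : ∀ (i : Fin 5) (k : Fin 4), i.succAbove k = 
    (![![1,2,3,4],![0,2,3,4],![0,1,3,4],![0,1,2,4],![0,1,2,3]] : Fin 5 → Fin 4 → Fin 5) i k := by
    decide
  simp only [r, Matrix.cons_val]
  generalize unitOf (det2 (p 0) (p 1)) = a01
  generalize unitOf (det2 (p 0) (p 2)) = a02
  generalize unitOf (det2 (p 0) (p 3)) = a03
  generalize unitOf (det2 (p 0) (p 4)) = a04
  generalize unitOf (det2 (p 1) (p 2)) = a12
  generalize unitOf (det2 (p 1) (p 3)) = a13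
  generalize unitOf (det2 (p 1) (p 4)) = a14
  generalize unitOf (det2 (p 2) (p 3)) = a23
  generalize unitOf (det2 (p 2) (p 4)) = a24
  generalize unitOf (det2 (p 3) (p 4)) = a34
  simp only [map_add, map_sub, LinearMap.add_apply, LinearMap.sub_apply, wedgeBilin_self]
  simp only [wedgeBilin_swap a34 a14, wedgeBilin_swap a24 a14, wedgeBilin_swap a34 a23,
    wedgeBilin_swap a24 a23, wedgeBilin_swap a34 a13, wedgeBilin_swap a24 a13, wedgeBilin_swap
    a34 a24, wedgeBilin_swap a34 a04, wedgeBilin_swap a24 a04, wedgeBilin_swap a34 a03,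
    wedgeBilin_swap a24 a03, wedgeBilin_swap a14 a04, wedgeBilin_swap a14 a13, wedgeBilin_swap
    a14 a03, wedgeBilin_swap a24 a12, wedgeBilin_swap a14 a12, wedgeBilin_swap a24 a02,
    wedgeBilin_swap a14 a02, wedgeBilin_swap a23 a03, wedgeBilin_swap a23 a13, wedgeBilin_swap a13 a03, wedgeBilin_swap
    a23 a12, wedgeBilin_swap a13 a12, wedgeBilin_swap a23 a02, wedgeBilin_swap a13 a02]
  norm_num
  abel

/-- The map `δ : B₂(F) → ⋀² F^×`, `[x]₂ ↦ (1 - x) ∧ x`. -/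
def delta2 (F : Type*) [Field F] : B2 F →ₗ[ℤ] Wedge2 F :=
  (QuotientAddGroup.lift (R2 F) (delta2Pre F) R2_le_ker).toIntLinearMap

lemma delta2_symbB2 {x : F} (h0 : x ≠ 0) (h1 : x ≠ 1) :
    delta2 F (symbB2 x) = wedge (unitOf (1 - x)) (unitOf x) :=
  delta2Pre_intSymb h0 h1

/-- The `F`-linear map `[a] ↦ a ⊗ a + (1 - a) ⊗ (1 - a)`. -/
def bdry2Pre (F : Type*) [Field F] : (Punctured F →₀ F) →ₗ[F] F ⊗[ℤ] MulGroup F :=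
  Finsupp.linearCombination F fun a : Punctured F =>
    a.1 ⊗ₜ[ℤ] unitOf a.1 + (1 - a.1) ⊗ₜ[ℤ] unitOf (1 - a.1)

lemma bdry2Pre_symb (D : Derivation ℤ F F) {x : F} (h0 : x ≠ 0) (h1 : x ≠ 1) :
    bdry2Pre F (symb D x) =
      -(dlog D (1 - x) ⊗ₜ[ℤ] unitOf x) + dlog D x ⊗ₜ[ℤ] unitOf (1 - x) := by
  have h : (1 : F) - x ≠ 0 := sub_ne_zero.mpr (Ne.symm h1)
  simp only [bdry2Pre, symb, h0, h1, ne_eq, not_false_eq_true, and_self, dif_pos,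
    Finsupp.linearCombination_single, smul_add, TensorProduct.smul_tmul', smul_eq_mul, dlog,
    ← TensorProduct.neg_tmul]
  congr 2
  · simp only [map_sub, Derivation.map_one_eq_zero]
    field_simp
    ring
  · field_simp

lemma fiveTerm_le_ker [NeZero (2 : F)] (D : Derivation ℤ F F) :
    fiveTerm D ≤ LinearMap.ker (bdry2Pre F) := by
  rw [fiveTerm, Submodule.span_le]
  rintro z ⟨a, b, ha0, ha1, hb0, hb1, hab, rfl⟩
  have hA : 1 - a ≠ 0 := sub_ne_zero.mpr (Ne.symm ha1)
  have hB : 1 - b ≠ 0 := sub_ne_zero.mpr (Ne.symm hb1)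
  have hC : a - b ≠ 0 := sub_ne_zero.mpr hab
  have e1 : (1 - b⁻¹) / (1 - a⁻¹) = (a * (1 - b)) / (b * (1 - a)) := by
    have : a - 1 ≠ 0 := sub_ne_zero.mpr ha1
    field_simp
    ring
  have e2 : 1 - b / a = (a - b) / a := by field_simp
  have e3 : 1 - (1 - b) / (1 - a) = -((a - b) / (1 - a)) := by field_simp; ring
  have e4 : 1 - (a * (1 - b)) / (b * (1 - a)) = -((a - b) / (b * (1 - a))) := by
    field_simp; ring
  have n2 : b / a ≠ 1 := by rw [ne_eq, div_eq_one_iff_eq ha0]; exact fun h => hab h.symm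
  have n3 : (1 - b) / (1 - a) ≠ 1 := fun h => by
    rw [h, sub_self, eq_comm, neg_eq_zero] at e3
    exact div_ne_zero hC hA e3
  have n4 : (a * (1 - b)) / (b * (1 - a)) ≠ 1 := fun h => by
    rw [h, sub_self, eq_comm, neg_eq_zero] at e4
    exact div_ne_zero hC (mul_ne_zero hb0 hA) e4
  rw [e1, SetLike.mem_coe, LinearMap.mem_ker]
  simp only [map_add, map_sub]
  rw [bdry2Pre_symb D ha0 ha1, bdry2Pre_symb D hb0 hb1,
    bdry2Pre_symb D (div_ne_zero hb0 ha0) n2, bdry2Pre_symb D (div_ne_zero hB hA) n3,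
    bdry2Pre_symb D (div_ne_zero (mul_ne_zero ha0 hB) (mul_ne_zero hb0 hA)) n4, e2, e3, e4,
    tmul_unitOf_neg _ (div_ne_zero hC hA),
    tmul_unitOf_neg _ (div_ne_zero hC (mul_ne_zero hb0 hA))]
  simp only [dlog_neg, dlog_div D hC ha0, dlog_div D hC hA, dlog_div D hb0 ha0,
    dlog_div D hB hA, dlog_div D hC (mul_ne_zero hb0 hA),
    dlog_div D (mul_ne_zero ha0 hB) (mul_ne_zero hb0 hA), dlog_mul D hb0 hA, dlog_mul D ha0 hB,
    unitOf_div hC ha0, unitOf_div hC hA, unitOf_div hb0 ha0,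
    unitOf_div hB hA, unitOf_div hC (mul_ne_zero hb0 hA),
    unitOf_div (mul_ne_zero ha0 hB) (mul_ne_zero hb0 hA), unitOf_mul hb0 hA, unitOf_mul ha0 hB,
    TensorProduct.tmul_add, TensorProduct.add_tmul, TensorProduct.tmul_sub,
    TensorProduct.sub_tmul]
  abel

/-- The map `∂ᴰ : β₂ᴰ(F) → F ⊗ F^×` with
`⟦a⟧₂ᴰ ↦ -D(1 - a) / (1 - a) ⊗ a + D(a) / a ⊗ (1 - a)` (see `bdry2_symb2`). -/
def bdry2 [NeZero (2 : F)] (D : Derivation ℤ F F) : Beta2 D →ₗ[F] F ⊗[ℤ] MulGroup F :=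
  (fiveTerm D).liftQ (bdry2Pre F) (fiveTerm_le_ker D) ∘ₗ (beta2Sub D).subtype

lemma bdry2_symb2 [NeZero (2 : F)] (D : Derivation ℤ F F) {x : F} (h0 : x ≠ 0) (h1 : x ≠ 1) :
    bdry2 D (symb2 D x) =
      -(dlog D (1 - x) ⊗ₜ[ℤ] unitOf x) + dlog D x ⊗ₜ[ℤ] unitOf (1 - x) :=
  bdry2Pre_symb D h0 h1

/-- The map `(F ⊗ F^×) ⊗ F^× → F ⊗ ⋀² F^×`, `(x ⊗ a) ⊗ b ↦ x ⊗ (a ∧ b)`. -/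
def wedgeMap (F : Type*) [Field F] :
    (F ⊗[ℤ] MulGroup F) ⊗[ℤ] MulGroup F →ₗ[F] F ⊗[ℤ] Wedge2 F :=
  TensorProduct.AlgebraTensorModule.map LinearMap.id (TensorProduct.lift (wedgeBilin F)) ∘ₗ
    (TensorProduct.AlgebraTensorModule.assoc ℤ ℤ F F (MulGroup F) (MulGroup F)).toLinearMap

lemma wedgeMap_tmul (x : F) (a b : MulGroup F) :
    wedgeMap F ((x ⊗ₜ[ℤ] a) ⊗ₜ[ℤ] b) = x ⊗ₜ[ℤ] wedge a b := rfl

/-- The differential `(β₂ᴰ(F) ⊗ F^×) ⊕ (F ⊗ B₂(F)) → F ⊗ ⋀² F^×`. -/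
def bdryMid [NeZero (2 : F)] (D : Derivation ℤ F F) : Mid D →ₗ[F] F ⊗[ℤ] Wedge2 F :=
  LinearMap.coprod
    (-(wedgeMap F ∘ₗ TensorProduct.AlgebraTensorModule.map (bdry2 D) LinearMap.id))
    (TensorProduct.AlgebraTensorModule.map LinearMap.id (delta2 F))

lemma bdryMid_apply [NeZero (2 : F)] (D : Derivation ℤ F F) {a y : F} (x : F) (b : MulGroup F)
    (ha0 : a ≠ 0) (ha1 : a ≠ 1) (hy0 : y ≠ 0) (hy1 : y ≠ 1) :
    bdryMid D (symb2 D a ⊗ₜ[ℤ] b, x ⊗ₜ[ℤ] symbB2 y) =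
      dlog D (1 - a) ⊗ₜ[ℤ] wedge (unitOf a) b - dlog D a ⊗ₜ[ℤ] wedge (unitOf (1 - a)) b
        + x ⊗ₜ[ℤ] wedge (unitOf (1 - y)) (unitOf y) := by
  simp only [bdryMid, LinearMap.coprod_apply, LinearMap.neg_apply, LinearMap.comp_apply,
    TensorProduct.AlgebraTensorModule.map_tmul, bdry2_symb2 D ha0 ha1, LinearMap.id_apply,
    TensorProduct.add_tmul, TensorProduct.neg_tmul, map_add, map_neg, wedgeMap_tmul,
    delta2_symbB2 hy0 hy1]
  abel

lemma bdry3Pre_symb (D : Derivation ℤ F F) {x : F} (h0 : x ≠ 0) (h1 : x ≠ 1) :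
    bdry3Pre D (symb D x) = (symb2 D x ⊗ₜ[ℤ] unitOf x, dlog D x ⊗ₜ[ℤ] symbB2 x) := by
  have h : (1 : F) - x ≠ 0 := sub_ne_zero.mpr (Ne.symm h1)
  by_cases hD : D x = 0
  · have hs : symb D x = 0 := by simp [symb, hD]
    have hs2 : symb2 D x = 0 := by
      apply Subtype.ext
      simp [symb2, hs]
    simp only [hs, hs2, dlog, hD, map_zero, zero_div, TensorProduct.zero_tmul]
    rfl
  · have hc : D x / (x * (1 - x)) ≠ 0 := div_ne_zero hD (mul_ne_zero h0 h)
    simp only [bdry3Pre, symb, h0, h1, ne_eq, not_false_eq_true, and_self, dif_pos,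
      Finsupp.linearCombination_single, smul_smul, mul_inv_cancel₀ hc, one_smul]

lemma bdry3_symb3 (D : Derivation ℤ F F) {x : F} (h0 : x ≠ 0) (h1 : x ≠ 1) :
    bdry3 D (symb3 D x) = (symb2 D x ⊗ₜ[ℤ] unitOf x, dlog D x ⊗ₜ[ℤ] symbB2 x) :=
  bdry3Pre_symb D h0 h1

/-! ### Consequences of the five-term relation -/

lemma symb2_fiveTerm (D : Derivation ℤ F F) {a b : F} (ha0 : a ≠ 0) (ha1 : a ≠ 1)
    (hb0 : b ≠ 0) (hb1 : b ≠ 1) (hab : a ≠ b) :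
    symb2 D a - symb2 D b + symb2 D (b / a) - symb2 D ((1 - b) / (1 - a))
      + symb2 D ((1 - b⁻¹) / (1 - a⁻¹)) = 0 := by
  apply Subtype.ext
  have h : (fiveTerm D).mkQ (symb D a - symb D b + symb D (b / a) - symb D ((1 - b) / (1 - a))
      + symb D ((1 - b⁻¹) / (1 - a⁻¹))) = 0 := by
    rw [← LinearMap.mem_ker, Submodule.ker_mkQ]
    exact Submodule.subset_span ⟨a, b, ha0, ha1, hb0, hb1, hab, rfl⟩
  simp only [map_add, map_sub] at h
  exact h

lemma symb2_inv_aux (D : Derivation ℤ F F) {u w : F} (hu0 : u ≠ 0) (hu1 : u ≠ 1)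
    (hw0 : w ≠ 0) (hw1 : w ≠ 1) (huw : u ≠ w) :
    symb2 D u + symb2 D u⁻¹ - (symb2 D w + symb2 D w⁻¹)
      + (symb2 D (w / u) + symb2 D (u / w)) = 0 := by
  have hC : u - w ≠ 0 := sub_ne_zero.mpr huw
  have hW : 1 - w ≠ 0 := sub_ne_zero.mpr (Ne.symm hw1)
  have hU : u - 1 ≠ 0 := sub_ne_zero.mpr hu1
  obtain ⟨a, ha⟩ : ∃ a, a = (1 - w) / (u - w) := ⟨_, rfl⟩
  obtain ⟨b, hb⟩ : ∃ b, b = u * a := ⟨_, rfl⟩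
  have ha0 : a ≠ 0 := ha ▸ div_ne_zero hW hC
  have hb0 : b ≠ 0 := hb ▸ mul_ne_zero hu0 ha0
  have hA : 1 - a = (u - 1) / (u - w) := by rw [ha]; field_simp; ring
  have hB : 1 - b = w * (1 - a) := by rw [hA, hb, ha]; field_simp; ring
  have hA0 : 1 - a ≠ 0 := hA ▸ div_ne_zero hU hC
  have hB0 : 1 - b ≠ 0 := hB ▸ mul_ne_zero hw0 hA0
  have ha1 : a ≠ 1 := fun h => hA0 (by rw [h, sub_self])
  have hb1 : b ≠ 1 := fun h => hB0 (by rw [h, sub_self])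
  have hab : a ≠ b := fun h => hu1 (mul_right_cancel₀ ha0 (by rw [one_mul, ← hb, ← h]))
  have e1 : b / a = u := by rw [hb, mul_div_cancel_right₀ _ ha0]
  have e2 : a / b = u⁻¹ := by rw [← e1, inv_div]
  have e3 : (1 - b) / (1 - a) = w := by rw [hB, mul_div_cancel_right₀ _ hA0]
  have e4 : (1 - a) / (1 - b) = w⁻¹ := by rw [← e3, inv_div]
  have i1 : 1 - a⁻¹ = -((1 - a) / a) := by field_simp; ring
  have i2 : 1 - b⁻¹ = -((1 - b) / b) := by field_simp; ring
  have e5 : (1 - b⁻¹) / (1 - a⁻¹) = w / u := by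
    rw [i1, i2, neg_div_neg_eq, div_div_div_eq, ← e1, ← e3, div_div_div_eq, mul_comm b]
  have e6 : (1 - a⁻¹) / (1 - b⁻¹) = u / w := by rw [← inv_div, e5, inv_div]
  have h1 := symb2_fiveTerm D ha0 ha1 hb0 hb1 hab
  have h2 := symb2_fiveTerm D hb0 hb1 ha0 ha1 (Ne.symm hab)
  rw [e1, e3, e5] at h1
  rw [e2, e4, e6] at h2
  rw [← add_zero (0 : Beta2 D)]
  nth_rewrite 1 [← h1]
  rw [← h2]
  abel

lemma symb2_inv_of [NeZero (2 : F)] (D : Derivation ℤ F F) {t u : F} (ht0 : t ≠ 0) (ht1 : t ≠ 1)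
    (hu0 : u ≠ 0) (hu1 : u ≠ 1) (hut : u * t ≠ 1) : symb2 D t⁻¹ = -symb2 D t := by
  have hw0 : u * t ≠ 0 := mul_ne_zero hu0 ht0
  have huw : u ≠ u * t := fun h => ht1 (mul_left_cancel₀ hu0 (by rw [mul_one, ← h]))
  have h1 := symb2_inv_aux D hu0 hu1 hw0 hut huw
  have h2 := symb2_inv_aux D hw0 hut hu0 hu1 (Ne.symm huw)
  have e1 : u * t / u = t := mul_div_cancel_left₀ _ hu0
  have e2 : u / (u * t) = t⁻¹ := by rw [← inv_div, e1]
  rw [e1, e2] at h1 h2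
  have h3 : (2 : F) • (symb2 D t⁻¹ + symb2 D t) = 0 := by
    rw [two_smul, ← add_zero (0 : Beta2 D)]
    nth_rewrite 1 [← h1]
    rw [← h2]
    abel
  rw [smul_eq_zero] at h3
  exact eq_neg_of_add_eq_zero_left (h3.resolve_left (NeZero.ne _))

/-- If `F ∖ {0, 1}` has two elements, then the inversion relation holds. -/
lemma symb2_inv [NeZero (2 : F)] (D : Derivation ℤ F F) {t a b : F} (ht0 : t ≠ 0) (ht1 : t ≠ 1)
    (ha0 : a ≠ 0) (ha1 : a ≠ 1) (hb0 : b ≠ 0) (hb1 : b ≠ 1) (hab : a ≠ b) :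
    symb2 D t⁻¹ = -symb2 D t := by
  by_cases h : a * t = 1
  · refine symb2_inv_of D ht0 ht1 hb0 hb1 fun h' => hab ?_
    exact mul_right_cancel₀ ht0 (h.trans h'.symm)
  · exact symb2_inv_of D ht0 ht1 ha0 ha1 h

lemma succAbove_five (i : Fin 5) (k : Fin 4) : i.succAbove k =
    (![![1, 2, 3, 4], ![0, 2, 3, 4], ![0, 1, 3, 4], ![0, 1, 2, 4], ![0, 1, 2, 3]] :
      Fin 5 → Fin 4 → Fin 5) i k := by
  revert i k; decide

/-- The five-term relation of the cross-ratio in `β₂ᴰ(F)`. -/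
lemma symb2_crossRatio [NeZero (2 : F)] (D : Derivation ℤ F F) (p : Fin 5 → Fin 2 → F)
    (hp : ∀ i j, i ≠ j → det2 (p i) (p j) ≠ 0) :
    ∑ i : Fin 5, (-1 : ℤ) ^ (i : ℕ) • symb2 D (crossRatio fun k => p (i.succAbove k)) = 0 := by
  have hr : ∀ i : Fin 5, _ := fun i => crossRatio_ne (p := fun k => p (i.succAbove k))
    (fun a b hab => hp _ _ (fun h => hab (Fin.succAbove_right_injective h)))
  obtain ⟨a, ha⟩ : ∃ a, a = crossRatio fun k => p ((4 : Fin 5).succAbove k) := ⟨_, rfl⟩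
  obtain ⟨b, hb⟩ : ∃ b, b = crossRatio fun k => p ((3 : Fin 5).succAbove k) := ⟨_, rfl⟩
  obtain ⟨ha0, ha1, hA⟩ := hr 4
  obtain ⟨hb0, hb1, hB⟩ := hr 3
  obtain ⟨hz0, hz1, -⟩ := hr 1
  obtain ⟨hw0, hw1, -⟩ := hr 0
  obtain ⟨-, hq1, -⟩ := hr 2
  rw [← ha] at ha0 ha1 hA
  rw [← hb] at hb0 hb1 hB
  have d01 := hp 0 1 (by decide)
  have d02 := hp 0 2 (by decide)
  have d03 := hp 0 3 (by decide)
  have d04 := hp 0 4 (by decide)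
  have d12 := hp 1 2 (by decide)
  have d13 := hp 1 3 (by decide)
  have d14 := hp 1 4 (by decide)
  have d23 := hp 2 3 (by decide)
  have d24 := hp 2 4 (by decide)
  have d34 := hp 3 4 (by decide)
  have e2 : (crossRatio fun k => p ((2 : Fin 5).succAbove k)) = b / a := by
    rw [ha, hb]
    simp only [crossRatio, succAbove_five, Matrix.cons_val]
    field_simp
  have e0 : (crossRatio fun k => p ((0 : Fin 5).succAbove k))⁻¹ = (1 - b) / (1 - a) := by
    rw [hA, hB]
    simp only [crossRatio, succAbove_five, Matrix.cons_val]
    field_simp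
  have e1 : (crossRatio fun k => p ((1 : Fin 5).succAbove k))⁻¹ = (1 - b⁻¹) / (1 - a⁻¹) := by
    have i1 : 1 - a⁻¹ = -((1 - a) / a) := by field_simp; ring
    have i2 : 1 - b⁻¹ = -((1 - b) / b) := by field_simp; ring
    rw [i1, i2, neg_div_neg_eq, hA, hB, ha, hb]
    simp only [crossRatio, succAbove_five, Matrix.cons_val]
    field_simp
  have hab : a ≠ b := fun h => hq1 (by rw [e2, h, div_self hb0])
  have h5 := symb2_fiveTerm D ha0 ha1 hb0 hb1 hab
  rw [← e2, ← e0, ← e1, symb2_inv D hw0 hw1 ha0 ha1 hb0 hb1 hab,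
    symb2_inv D hz0 hz1 ha0 ha1 hb0 hb1 hab, ha, hb] at h5
  rw [Fin.sum_univ_five, ← h5]
  norm_num
  abel

/-- The five-term relation of the cross-ratio in `B₂(F)`. -/
lemma symbB2_crossRatio (p : Fin 5 → Fin 2 → F)
    (hp : ∀ i j, i ≠ j → det2 (p i) (p j) ≠ 0) :
    ∑ i : Fin 5, (-1 : ℤ) ^ (i : ℕ) • symbB2 (crossRatio fun k => p (i.succAbove k)) = 0 := by
  have h : QuotientAddGroup.mk' (R2 F) (∑ i : Fin 5, (-1 : ℤ) ^ (i : ℕ) •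
      intSymb (crossRatio fun k => p (i.succAbove k))) = 0 := by
    rw [← AddMonoidHom.mem_ker, QuotientAddGroup.ker_mk']
    exact AddSubgroup.subset_closure ⟨p, hp, rfl⟩
  simp only [map_sum, map_zsmul] at h
  exact h

end Symbols

/-! ## The Grassmannian complex -/

section Grassmannian

variable {F : Type*} [Field F] {V : Type*} [AddCommGroup V] [Module F V]

/-- The `m`-tuples of vectors in generic position in a three-dimensional space: any three or fewer
of them are linearly independent. -/
abbrev Generic (F : Type*) [Field F] (V : Type*) [AddCommGroup V] [Module F V] (m : ℕ) :
    Type _ :=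
  {l : Fin m → V // ∀ s : Finset (Fin m), s.card ≤ 3 → LinearIndepOn F l (s : Set (Fin m))}

/-- The diagonal action of `GL(V)` on tuples in generic position. -/
instance genericAction (m : ℕ) : MulAction (V ≃ₗ[F] V) (Generic F V m) where
  smul g l := ⟨fun i => g (l.1 i), fun s hs =>
    (l.2 s hs).map_injOn g.toLinearMap g.injective.injOn⟩
  one_smul _ := rfl
  mul_smul _ _ _ := rfl

lemma smul_val {m : ℕ} (g : V ≃ₗ[F] V) (l : Generic F V m) (i : Fin m) :
    (g • l).1 i = g (l.1 i) := rfl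

/-- Configurations: tuples in generic position modulo `GL(V)`. -/
abbrev Config (F : Type*) [Field F] (V : Type*) [AddCommGroup V] [Module F V] (m : ℕ) : Type _ :=
  MulAction.orbitRel.Quotient (V ≃ₗ[F] V) (Generic F V m)

/-- `C_m(3)`: the free abelian group generated by the configurations of `m` vectors. -/
abbrev Chain (F : Type*) [Field F] (V : Type*) [AddCommGroup V] [Module F V] (m : ℕ) : Type _ :=
  FreeAbelianGroup (Config F V m)

/-- The generator `(l_0, …, l_{m-1})` of `C_m(3)`. -/
def conf {m : ℕ} (l : Generic F V m) : Chain F V m :=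
  FreeAbelianGroup.of (Quotient.mk _ l)

/-- The additive map on `C_m(3)` defined by a `GL(V)`-invariant function on generic tuples. -/
def chainLift {m : ℕ} {A : Type*} [AddCommGroup A] (f : Generic F V m → A)
    (hf : ∀ (g : V ≃ₗ[F] V) (l : Generic F V m), f (g • l) = f l) : Chain F V m →+ A :=
  FreeAbelianGroup.lift (Quotient.lift f (by rintro _ l ⟨g, rfl⟩; exact hf g l))

lemma chainLift_conf {m : ℕ} {A : Type*} [AddCommGroup A] (f : Generic F V m → A)
    (hf : ∀ (g : V ≃ₗ[F] V) (l : Generic F V m), f (g • l) = f l) (l : Generic F V m) :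
    chainLift f hf (conf l) = f l := by
  simp [chainLift, conf]

/-- Omitting the `i`-th vector. -/
def face {m : ℕ} (i : Fin (m + 1)) (l : Generic F V (m + 1)) : Generic F V m :=
  ⟨fun k => l.1 (i.succAbove k), fun s hs => by
    refine LinearIndepOn.comp_of_image (f := i.succAbove) ?_
      Fin.succAbove_right_injective.injOn
    have := l.2 (s.map i.succAboveEmb) (by simpa using hs)
    simpa using this⟩

/-- The differential `(l_0, …, l_m) ↦ ∑ (-1)^i (l_0, …, l̂_i, …, l_m)`. -/
def grassD (F : Type*) [Field F] (V : Type*) [AddCommGroup V] [Module F V] (m : ℕ) :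
    Chain F V (m + 1) →+ Chain F V m :=
  chainLift (fun l => ∑ i : Fin (m + 1), (-1 : ℤ) ^ (i : ℕ) • conf (face i l)) fun g l => by
    refine Finset.sum_congr rfl fun i _ => ?_
    have h : (Quotient.mk _ (face i (g • l)) : Config F V m) = Quotient.mk _ (face i l) :=
      Quotient.sound (s := MulAction.orbitRel _ _) ⟨g, rfl⟩
    rw [conf, conf, h]

/-- Volume forms on `V`: nonzero alternating forms of degree three. -/
abbrev VolumeForm (F : Type*) [Field F] (V : Type*) [AddCommGroup V] [Module F V] : Type _ :=
  {ω : V [⋀^Fin 3]→ₗ[F] F // ω ≠ 0}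

/-- The determinant `Δ(x, y, z) = ⟨ω, x ∧ y ∧ z⟩`. -/
def vol (ω : VolumeForm F V) (x y z : V) : F := ω.1 ![x, y, z]

/-- The projected cross-ratio `r(x | y_0, y_1, y_2, y_3)`. -/
def projRatio (ω : VolumeForm F V) (x : V) (y : Fin 4 → V) : F :=
  (vol ω x (y 0) (y 3) * vol ω x (y 1) (y 2)) / (vol ω x (y 0) (y 2) * vol ω x (y 1) (y 3))

/-- The triple-ratio of six vectors. -/
def tripleRatio (ω : VolumeForm F V) (l : Fin 6 → V) : F :=
  (vol ω (l 0) (l 1) (l 3) * vol ω (l 1) (l 2) (l 4) * vol ω (l 2) (l 0) (l 5)) /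
    (vol ω (l 0) (l 1) (l 4) * vol ω (l 1) (l 2) (l 5) * vol ω (l 2) (l 0) (l 3))

/-- The determinant of the three vectors left from `l_0, …, l_3` after omitting `l_i`. -/
def omitVol (ω : VolumeForm F V) (l : Fin 4 → V) (i : Fin 4) : F :=
  vol ω (l (i.succAbove 0)) (l (i.succAbove 1)) (l (i.succAbove 2))

/-- The product over `j ≠ i` of the determinants of the three vectors left from `l_0, …, l_4` after
omitting `l_i` and `l_j`. -/
def omitProd (ω : VolumeForm F V) (l : Fin 5 → V) (i : Fin 5) : F :=
  ∏ k : Fin 4, omitVol ω (fun a => l (i.succAbove a)) k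

/-- The value of `τ₀` on `(l_0, …, l_3)`; the indices are taken modulo `4`. -/
def tau0Val (D : Derivation ℤ F F) (ω : VolumeForm F V) (l : Fin 4 → V) : F ⊗[ℤ] Wedge2 F :=
  ∑ i : Fin 4, (-1 : ℤ) ^ (i : ℕ) • (dlog D (omitVol ω l i) ⊗ₜ[ℤ]
    wedge (unitOf (omitVol ω l (i + 1) / omitVol ω l (i + 2)))
      (unitOf (omitVol ω l (i + 3) / omitVol ω l (i + 2))))

/-- The value of `τ₁` on `(l_0, …, l_4)`. -/
def tau1Val (D : Derivation ℤ F F) (ω : VolumeForm F V) (l : Fin 5 → V) : Mid D :=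
  (-(1 / 3) : F) • ∑ i : Fin 5, (-1 : ℤ) ^ (i : ℕ) •
    ((symb2 D (projRatio ω (l i) fun k => l (i.succAbove k)) ⊗ₜ[ℤ] unitOf (omitProd ω l i),
      dlog D (omitProd ω l i) ⊗ₜ[ℤ] symbB2 (projRatio ω (l i) fun k => l (i.succAbove k))) :
      Mid D)

/-- The value of `τ₂` on `(l_0, …, l_5)`: an alternating sum over the symmetric group. -/
def tau2Val (D : Derivation ℤ F F) (ω : VolumeForm F V) (l : Fin 6 → V) : Beta3 D :=
  (-(1 / 90) : F) • ∑ σ : Equiv.Perm (Fin 6), (Equiv.Perm.sign σ : ℤ) •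
    symb3 D (tripleRatio ω fun k => l (σ k))

/-! ### Invariance of the three maps under `GL(V)` -/

lemma vol_linearEquiv (ω : VolumeForm F V) [Fact (Module.finrank F V = 3)] (g : V ≃ₗ[F] V)  :
    ∃ c : F, c ≠ 0 ∧ ∀ x y z : V, vol ω (g x) (g y) (g z) = c * vol ω x y z := by
  have hV : Module.finrank F V = 3 := Fact.out
  have : Module.Finite F V := Module.finite_of_finrank_pos (by omega)
  let e : Module.Basis (Fin 3) F V := Module.finBasisOfFinrankEq F V hV
  refine ⟨LinearMap.det (g : V →ₗ[F] V), g.isUnit_det'.ne_zero, fun x y z => ?_⟩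
  have h : ![g x, g y, g z] = (g : V →ₗ[F] V) ∘ ![x, y, z] := by
    ext i; fin_cases i <;> rfl
  rw [vol, vol, h, ω.1.eq_smul_basis_det e, AlternatingMap.smul_apply, AlternatingMap.smul_apply,
    Module.Basis.det_comp, smul_eq_mul, smul_eq_mul]
  ring

/-- A volume form in coordinates. -/
lemma vol_coord (ω : VolumeForm F V) [Fact (Module.finrank F V = 3)] :
    ∃ (c : F) (f : V → Fin 3 → F), ∀ x y z : V, vol ω x y z =
      c * (f x 0 * f y 1 * f z 2 - f x 0 * f z 1 * f y 2 - f y 0 * f x 1 * f z 2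
        + f y 0 * f z 1 * f x 2 + f z 0 * f x 1 * f y 2 - f z 0 * f y 1 * f x 2) := by
  have hV : Module.finrank F V = 3 := Fact.out
  have : Module.Finite F V := Module.finite_of_finrank_pos (by omega)
  let e : Module.Basis (Fin 3) F V := Module.finBasisOfFinrankEq F V hV
  refine ⟨ω.1 e, fun x => e.repr x, fun x y z => ?_⟩
  rw [vol, ω.1.eq_smul_basis_det e, AlternatingMap.smul_apply, smul_eq_mul,
    Module.Basis.det_apply, Matrix.det_fin_three]
  simp only [AlternatingMap.smul_apply, Module.Basis.det_self, smul_eq_mul, mul_one,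
    Module.Basis.toMatrix_apply, Matrix.cons_val]

lemma vol_ne_zero (ω : VolumeForm F V) [Fact (Module.finrank F V = 3)] {m : ℕ}
    (l : Generic F V m) {i j k : Fin m} (hij : i ≠ j) (hik : i ≠ k) (hjk : j ≠ k) :
    vol ω (l.1 i) (l.1 j) (l.1 k) ≠ 0 := by
  have hV : Module.finrank F V = 3 := Fact.out
  have : Module.Finite F V := Module.finite_of_finrank_pos (by omega)
  have hinj : Function.Injective ![i, j, k] := by
    intro a b
    fin_cases a <;> fin_cases b <;> simp [hij, hik, hjk, hij.symm, hik.symm, hjk.symm]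
  have h1 := l.2 {i, j, k} Finset.card_le_three
  have h2 : LinearIndependent F ![l.1 i, l.1 j, l.1 k] := by
    have h3 := LinearIndependent.comp h1
      (fun a : Fin 3 => ⟨![i, j, k] a, by fin_cases a <;> simp⟩)
      (fun a b hab => hinj (congrArg Subtype.val hab))
    convert h3 using 1
    ext a
    fin_cases a <;> rfl
  have h4 := (AlternatingMap.map_basis_ne_zero_iff
    (basisOfLinearIndependentOfCardEqFinrank h2 (by simp [hV])) ω.1).mpr ω.2
  rwa [coe_basisOfLinearIndependentOfCardEqFinrank] at h4

lemma det2_swap (u v : Fin 2 → F) : det2 u v = -det2 v u := by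
  simp only [det2]; ring

/-- Five vectors in generic position in a three-dimensional space have a dual configuration of
five points of the projective line with the same cross-ratios. -/
lemma exists_dual (ω : VolumeForm F V) [Fact (Module.finrank F V = 3)] (l : Generic F V 5) :
    ∃ p : Fin 5 → Fin 2 → F, (∀ i j, i ≠ j → det2 (p i) (p j) ≠ 0) ∧
      ∀ i : Fin 5, projRatio ω (l.1 i) (fun k => l.1 (i.succAbove k)) =
        crossRatio fun k => p (i.succAbove k) := by
  obtain ⟨c, f, hf⟩ := vol_coord ω
  have sw1 : ∀ x y z, vol ω y x z = -vol ω x y z := fun x y z => by rw [hf, hf]; ring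
  have sw2 : ∀ x y z, vol ω x z y = -vol ω x y z := fun x y z => by rw [hf, hf]; ring
  obtain ⟨v, hv⟩ : ∃ v : Fin 5 → Fin 5 → Fin 5 → F, 
      ∀ i j k, v i j k = vol ω (l.1 i) (l.1 j) (l.1 k) := ⟨_, fun _ _ _ => rfl⟩
  have nz : ∀ i j k, i ≠ j → i ≠ k → j ≠ k → v i j k ≠ 0 := fun i j k h1 h2 h3 => by
    rw [hv]; exact vol_ne_zero ω l h1 h2 h3
  have n012 := nz 0 1 2 (by decide) (by decide) (by decide)
  have n013 := nz 0 1 3 (by decide) (by decide) (by decide)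
  have n014 := nz 0 1 4 (by decide) (by decide) (by decide)
  have n023 := nz 0 2 3 (by decide) (by decide) (by decide)
  have n024 := nz 0 2 4 (by decide) (by decide) (by decide)
  have n034 := nz 0 3 4 (by decide) (by decide) (by decide)
  have n123 := nz 1 2 3 (by decide) (by decide) (by decide)
  have n124 := nz 1 2 4 (by decide) (by decide) (by decide)
  have n134 := nz 1 3 4 (by decide) (by decide) (by decide)
  have n234 := nz 2 3 4 (by decide) (by decide) (by decide)
  obtain ⟨p, hp⟩ : ∃ p : Fin 5 → Fin 2 → F, p = ![![v 1 2 3, v 1 2 4], ![-v 0 2 3, -v 0 2 4],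
    ![v 0 1 3, v 0 1 4], ![-v 0 1 2, 0], ![0, -v 0 1 2]] := ⟨_, rfl⟩
  have d34 : det2 (p 3) (p 4) = v 0 1 2 * v 0 1 2 := by simp [hp, det2]
  have d03 : det2 (p 0) (p 3) = v 0 1 2 * v 1 2 4 := by simp [hp, det2]; ring
  have d04 : det2 (p 0) (p 4) = -(v 0 1 2 * v 1 2 3) := by simp [hp, det2]; ring
  have d13 : det2 (p 1) (p 3) = -(v 0 1 2 * v 0 2 4) := by simp [hp, det2]; ring
  have d14 : det2 (p 1) (p 4) = v 0 1 2 * v 0 2 3 := by simp [hp, det2]; ring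
  have d23 : det2 (p 2) (p 3) = v 0 1 2 * v 0 1 4 := by simp [hp, det2]; ring
  have d24 : det2 (p 2) (p 4) = -(v 0 1 2 * v 0 1 3) := by simp [hp, det2]; ring
  have d01 : det2 (p 0) (p 1) = v 0 1 2 * v 2 3 4 := by
    simp [hp, det2, hv, hf]; ring
  have d02 : det2 (p 0) (p 2) = -(v 0 1 2 * v 1 3 4) := by
    simp [hp, det2, hv, hf]; ring
  have d12 : det2 (p 1) (p 2) = v 0 1 2 * v 0 3 4 := by
    simp [hp, det2, hv, hf]; ring
  refine ⟨p, ?_, ?_⟩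
  · have hlt : ∀ i j : Fin 5, i < j → det2 (p i) (p j) ≠ 0 := by
      clear hp hf hv sw1 sw2 nz
      intro i j hij
      fin_cases i <;> fin_cases j <;> first
        | exact absurd hij (by decide)
        | simp_all
    intro i j hij
    rcases lt_or_gt_of_ne hij with h | h
    · exact hlt i j h
    · rw [det2_swap]
      exact neg_ne_zero.mpr (hlt j i h)
  · have s1 : ∀ i j k, v j i k = -v i j k := fun i j k => by rw [hv, hv]; exact sw1 _ _ _
    have s2 : ∀ i j k, v i k j = -v i j k := fun i j k => by rw [hv, hv]; exact sw2 _ _ _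
    intro i
    simp only [projRatio, crossRatio, ← hv, succAbove_five]
    fin_cases i
    · simp only [Fin.zero_eta, Matrix.cons_val, d14, d23, d13, d24]
      field_simp
    · simp only [Fin.mk_one, Matrix.cons_val, d04, d23, d03, d24]
      rw [s1 0 1 4, s1 0 1 3]
      field_simp
    · simp only [Fin.reduceFinMk, Matrix.cons_val, d04, d13, d03, d14]
      rw [s1 0 2 4, s1 1 2 3, s1 0 2 3, s1 1 2 4]
      field_simp
    · simp only [Fin.reduceFinMk, Matrix.cons_val, d04, d12, d02, d14]
      rw [s1 0 3 4, s1 1 3 2, s1 0 3 2, s1 1 3 4, s2 1 2 3, s2 0 2 3]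
      field_simp
    · simp only [Fin.reduceFinMk, Matrix.cons_val, d03, d12, d02, d13]
      rw [s1 0 4 3, s1 1 4 2, s1 0 4 2, s1 1 4 3, s2 1 2 4, s2 0 2 4, s2 0 3 4, s2 1 3 4]
      field_simp

lemma symb2_projRatio [NeZero (2 : F)] (D : Derivation ℤ F F) (ω : VolumeForm F V)
    [Fact (Module.finrank F V = 3)] (l : Generic F V 5) :
    ∑ i : Fin 5, (-1 : ℤ) ^ (i : ℕ) •
      symb2 D (projRatio ω (l.1 i) fun k => l.1 (i.succAbove k)) = 0 := by
  obtain ⟨p, hp, h⟩ := exists_dual ω l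
  simp only [h]
  exact symb2_crossRatio D p hp

lemma symbB2_projRatio (ω : VolumeForm F V)
    [Fact (Module.finrank F V = 3)] (l : Generic F V 5) :
    ∑ i : Fin 5, (-1 : ℤ) ^ (i : ℕ) •
      symbB2 (projRatio ω (l.1 i) fun k => l.1 (i.succAbove k)) = 0 := by
  obtain ⟨p, hp, h⟩ := exists_dual ω l
  simp only [h]
  exact symbB2_crossRatio p hp

lemma omitVol_ne_zero (ω : VolumeForm F V) [Fact (Module.finrank F V = 3)]
    (l : Generic F V 4) (i : Fin 4) : omitVol ω l.1 i ≠ 0 :=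
  vol_ne_zero ω l (by revert i; decide) (by revert i; decide) (by revert i; decide)

lemma omitProd_ne_zero (ω : VolumeForm F V) [Fact (Module.finrank F V = 3)]
    (l : Generic F V 5) (i : Fin 5) : omitProd ω l.1 i ≠ 0 :=
  Finset.prod_ne_zero_iff.mpr fun k _ => omitVol_ne_zero ω (face i l) k

lemma tau0Val_smul (D : Derivation ℤ F F) (ω : VolumeForm F V) [Fact (Module.finrank F V = 3)]
    (g : V ≃ₗ[F] V) (l : Generic F V 4) : tau0Val D ω (g • l).1 = tau0Val D ω l.1 := by
  obtain ⟨c, hc, h⟩ := vol_linearEquiv ω g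
  have h1 : ∀ i, omitVol ω (g • l).1 i = c * omitVol ω l.1 i := fun i => h _ _ _
  have h0 := omitVol_ne_zero ω l
  simp only [tau0Val, h1, mul_div_mul_left _ _ hc, dlog_mul D hc (h0 _), unitOf_div (h0 _) (h0 _),
    Fin.sum_univ_four, ← wedgeBilin_apply, Fin.reduceAdd, zero_add]
  generalize unitOf (omitVol ω l.1 0) = a0
  generalize unitOf (omitVol ω l.1 1) = a1
  generalize unitOf (omitVol ω l.1 2) = a2
  generalize unitOf (omitVol ω l.1 3) = a3
  simp only [map_sub, LinearMap.sub_apply, wedgeBilin_self,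
    wedgeBilin_swap a2 a0, wedgeBilin_swap a3 a0, wedgeBilin_swap a3 a1, TensorProduct.add_tmul,
    TensorProduct.tmul_sub, TensorProduct.tmul_neg, TensorProduct.tmul_zero]
  norm_num
  abel

lemma tau1Val_smul [NeZero (2 : F)] (D : Derivation ℤ F F) (ω : VolumeForm F V)
    [Fact (Module.finrank F V = 3)]
    (g : V ≃ₗ[F] V) (l : Generic F V 5) : tau1Val D ω (g • l).1 = tau1Val D ω l.1 := by
  obtain ⟨c, hc, h⟩ := vol_linearEquiv ω g
  have h1 : ∀ i, omitProd ω (g • l).1 i = c ^ 4 * omitProd ω l.1 i := fun i => by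
    have h2 : ∀ k, omitVol ω (fun a => (g • l).1 (i.succAbove a)) k =
      c * omitVol ω (fun a => l.1 (i.succAbove a)) k := fun k => h _ _ _
    simp only [omitProd, h2, Finset.prod_mul_distrib, Finset.prod_const, Finset.card_univ,
      Fintype.card_fin]
  have h3 : ∀ i, projRatio ω ((g • l).1 i) (fun k => (g • l).1 (i.succAbove k)) =
      projRatio ω (l.1 i) (fun k => l.1 (i.succAbove k)) := fun i => by
    simp only [projRatio, smul_val, h, mul_mul_mul_comm c _ c]
    exact mul_div_mul_left _ _ (mul_ne_zero hc hc)
  have h0 := omitProd_ne_zero ω l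
  have hc4 : c ^ 4 ≠ 0 := pow_ne_zero _ hc
  have s1 := symb2_projRatio D ω l
  have s2 := symbB2_projRatio ω l
  have t1 := congrArg (fun z => z ⊗ₜ[ℤ] unitOf (c ^ 4)) s1
  have t2 := congrArg (fun z => dlog D (c ^ 4) ⊗ₜ[ℤ] z) s2
  simp only [TensorProduct.sum_tmul, TensorProduct.zero_tmul, ← TensorProduct.smul_tmul'] at t1
  simp only [TensorProduct.tmul_sum, TensorProduct.tmul_zero, TensorProduct.tmul_smul] at t2
  simp only [tau1Val, h1, h3, unitOf_mul hc4 (h0 _), dlog_mul D hc4 (h0 _)]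
  congr 1
  ext1
  · simp only [Prod.fst_sum, Prod.smul_fst, TensorProduct.tmul_add, smul_add,
      Finset.sum_add_distrib, t1, zero_add]
  · simp only [Prod.snd_sum, Prod.smul_snd, TensorProduct.add_tmul, smul_add,
      Finset.sum_add_distrib, t2, zero_add]

lemma tau2Val_smul (D : Derivation ℤ F F) (ω : VolumeForm F V) [Fact (Module.finrank F V = 3)]
    (g : V ≃ₗ[F] V) (l : Generic F V 6) : tau2Val D ω (g • l).1 = tau2Val D ω l.1 := by
  obtain ⟨c, hc, h⟩ := vol_linearEquiv ω g
  have h3 : ∀ σ : Equiv.Perm (Fin 6), tripleRatio ω (fun k => (g • l).1 (σ k)) =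
      tripleRatio ω (fun k => l.1 (σ k)) := fun σ => by
    simp only [tripleRatio, smul_val, h, mul_mul_mul_comm c _ c,
      mul_mul_mul_comm (c * c) _ c]
    exact mul_div_mul_left _ _ (mul_ne_zero (mul_ne_zero hc hc) hc)
  simp only [tau2Val, h3]

/-! ### The morphism -/

/-- `τ₀ : C_4(3) → F ⊗ ⋀² F^×`. -/
def tau0 (D : Derivation ℤ F F) (ω : VolumeForm F V) [Fact (Module.finrank F V = 3)] :
    Chain F V 4 →+ F ⊗[ℤ] Wedge2 F :=
  chainLift (fun l => tau0Val D ω l.1) (tau0Val_smul D ω)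

/-- `τ₁ : C_5(3) → (β₂ᴰ(F) ⊗ F^×) ⊕ (F ⊗ B₂(F))`. -/
def tau1 [NeZero (2 : F)] (D : Derivation ℤ F F) (ω : VolumeForm F V)
    [Fact (Module.finrank F V = 3)] : Chain F V 5 →+ Mid D :=
  chainLift (fun l => tau1Val D ω l.1) (tau1Val_smul D ω)

/-- `τ₂ : C_6(3) → β₃ᴰ(F)`. -/
def tau2 (D : Derivation ℤ F F) (ω : VolumeForm F V) [Fact (Module.finrank F V = 3)] :
    Chain F V 6 →+ Beta3 D :=
  chainLift (fun l => tau2Val D ω l.1) (tau2Val_smul D ω)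

end Grassmannian

end WeightThree

end

open scoped TensorProduct

noncomputable section

namespace WeightThree

/-! ### The rows, and an identity for alternating trilinear forms -/

section Rows

/-! The rows are short computations on generators. For the right square, `logPair` joins `D log x`
and the class of `x`, and `cyclicWedge` is an alternating trilinear form in such pairs. The boundary
of a summand of `tau1Val` is `cyclicWedge` of `1 - r`, `r` and `P_i`, where `r` and `1 - r` are
products and quotients of determinants by the Plücker relation. Also `tau0Val` is the alternating
sum of `cyclicWedge` over triples among four determinants (`tau0Val_eq`). The square is then
`alternating_five`, an identity valid for every alternating trilinear form in ten letters; its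
factor `-3` explains the `-1/3` in `tau1Val`.

For the left square, both components of the target have the same shape: a function `f` with the
five-term relation (`FiveTermFunction`), paired by some `ψ` additive in its multiplicative argument
(`LogPairing`). So one identity, `alternation_tripleRatio_eq_sum_faces`, is proved for all such `f`
and `ψ` and applied twice. The five-term relation makes `f` of a cross-ratio alternating in the four
points (`map_inv`, `map_div_sub_one`).

The alternating sum of `ψ(t)(f(t))`, `t` the triple-ratio, splits into six determinant terms, and
the symmetries of `t` make them all equal to the sum `T` weighted by `Δ(y_0, y_2, y_5)`. Let `Y`,
`Z`, `W` be the sums with the same weight of `f` at the cross-ratios `r(0|1,4,2,3)`, `r(0|1,4,2,5)`,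
`r(1|4,0,2,5)`. Five-term relations give `2T = -Y - Z` (through the point where the lines `y_1 y_4`
and `y_2 y_5` meet), `2Y = 3Z` (projection from one vector) and `3Z = -2W` (duality for five
vectors), hence `6T = 5W`. Finally `W` is six times the sum over faces occurring in `tau1Val`.
Altogether the factor is `5 * 6 = 30`, and `30/90 = 1/3`. -/

lemma chain_hom_ext {F : Type*} [Field F] {V : Type*} [AddCommGroup V] [Module F V] {m : ℕ}
    {A : Type*} [AddCommGroup A] {f g : Chain F V m →+ A}
    (h : ∀ l : Generic F V m, f (conf l) = g (conf l)) : f = g := by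
  refine FreeAbelianGroup.lift_ext _ _ fun q => ?_
  induction q using Quotient.inductionOn with
  | h l => exact h l

lemma grassD_five_conf {F : Type*} [Field F] {V : Type*} [AddCommGroup V] [Module F V]
    (l : Generic F V 6) :
    grassD F V 5 (conf l) = ∑ i : Fin 6, (-1 : ℤ) ^ (i : ℕ) • conf (face (m := 5) i l) :=
  chainLift_conf _ _ l

lemma grassD_four_conf {F : Type*} [Field F] {V : Type*} [AddCommGroup V] [Module F V]
    (l : Generic F V 5) :
    grassD F V 4 (conf l) = ∑ i : Fin 5, (-1 : ℤ) ^ (i : ℕ) • conf (face (m := 4) i l) :=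
  chainLift_conf _ _ l

lemma conf_face_face {F : Type*} [Field F] {V : Type*} [AddCommGroup V] [Module F V]
    (l : Generic F V 6) (i i' : Fin 6) (j j' : Fin 5)
    (h : ∀ k : Fin 4, i.succAbove (j.succAbove k) = i'.succAbove (j'.succAbove k)) :
    conf (face (m := 4) j (face (m := 5) i l)) = conf (face (m := 4) j' (face (m := 5) i' l)) :=
  congrArg conf (Subtype.ext (funext fun k => congrArg l.1 (h k)))

lemma grassD_comp_grassD (F : Type*) [Field F] (V : Type*) [AddCommGroup V] [Module F V] :
    (grassD F V 4).comp (grassD F V 5) = 0 := by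
  refine chain_hom_ext (m := 6) fun l => ?_
  refine (congrArg (grassD F V 4) (grassD_five_conf l)).trans ?_
  -- Only the values on generators matter; for an abstract `d` the domain is written with `5`
  -- instead of `4 + 1`.
  suffices h : ∀ d : Chain F V 5 →+ Chain F V 4, (∀ l : Generic F V 5,
      d (conf l) = ∑ i : Fin 5, (-1 : ℤ) ^ (i : ℕ) • conf (face (m := 4) i l)) →
      d (∑ i : Fin 6, (-1 : ℤ) ^ (i : ℕ) • conf (face (m := 5) i l)) = 0 from
    h (grassD F V 4) grassD_four_conf
  intro d h
  simp only [map_add, h, map_zsmul, Fin.sum_univ_six, Fin.sum_univ_five]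
  -- Each of the fifteen pairs of omitted vectors arises in two orders; the later-index-first order
  -- is replaced by the other one, and the signs are opposite.
  rw [conf_face_face l 1 0 0 0 (by decide),
    conf_face_face l 2 0 0 1 (by decide),
    conf_face_face l 3 0 0 2 (by decide),
    conf_face_face l 4 0 0 3 (by decide),
    conf_face_face l 5 0 0 4 (by decide),
    conf_face_face l 2 1 1 1 (by decide),
    conf_face_face l 3 1 1 2 (by decide),
    conf_face_face l 4 1 1 3 (by decide),
    conf_face_face l 5 1 1 4 (by decide),
    conf_face_face l 3 2 2 2 (by decide),
    conf_face_face l 4 2 2 3 (by decide),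
    conf_face_face l 5 2 2 4 (by decide),
    conf_face_face l 4 3 3 3 (by decide),
    conf_face_face l 5 3 3 4 (by decide),
    conf_face_face l 5 4 4 4 (by decide)]
  norm_num
  abel

/-- On a generator the term with `a ∧ a` vanishes, and `-D log a ⊗ (1 - a) ∧ a` from the first
summand cancels the image of `D log a ⊗ [a]₂`. This happens already before passing to the quotient
`β₃ᴰ(F)`. -/
lemma bdryMid_comp_bdry3 {F : Type*} [Field F] [NeZero (2 : F)] (D : Derivation ℤ F F) :
    bdryMid D ∘ₗ bdry3 D = 0 := by
  have h : bdryMid D ∘ₗ bdry3Pre D = 0 := by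
    refine Finsupp.lhom_ext fun a b => ?_
    have h : wedge (unitOf a.1) (unitOf a.1) = 0 := wedgeBilin_self _
    simp only [LinearMap.comp_apply, bdry3Pre, Finsupp.linearCombination_single, map_smul,
      bdryMid_apply D _ _ a.2.1 a.2.2 a.2.1 a.2.2, LinearMap.zero_apply, h,
      TensorProduct.tmul_zero, zero_sub, neg_add_cancel, smul_zero]
  refine LinearMap.ext fun z => ?_
  obtain ⟨z, rfl⟩ := Submodule.Quotient.mk_surjective _ z
  exact LinearMap.congr_fun h z

/-- The universal form of the right square. The letter `eij` stands for the logarithm of the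
determinant left after omitting `l_i` and `l_j`; the arguments of `A` on the left are then `1 - r`,
`r` and `P_i`, and on the right stand the four-term sums of `tau0Val_eq` on the five faces. `self₁`
is a separate hypothesis because `swap₁` alone yields only that twice the value vanishes. -/
lemma alternating_five {L N : Type*} [AddCommGroup L] [AddCommGroup N] (A : L → L → L → N)
    (add₁ : ∀ x x' y z, A (x + x') y z = A x y z + A x' y z)
    (swap₁ : ∀ x y z, A x y z = -A y x z) (swap₂ : ∀ x y z, A x y z = -A x z y)
    (self₁ : ∀ x y, A x x y = 0)
    (e01 e02 e03 e04 e12 e13 e14 e23 e24 e34 : L) :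
    A (e34 + e12 - (e24 + e13)) (e23 + e14 - (e24 + e13)) (e01 + e02 + e03 + e04)
      - A (e34 + e02 - (e24 + e03)) (e23 + e04 - (e24 + e03)) (e01 + e12 + e13 + e14)
      + A (e34 + e01 - (e14 + e03)) (e13 + e04 - (e14 + e03)) (e02 + e12 + e23 + e24)
      - A (e24 + e01 - (e14 + e02)) (e12 + e04 - (e14 + e02)) (e03 + e13 + e23 + e34)
      + A (e23 + e01 - (e13 + e02)) (e12 + e03 - (e13 + e02)) (e04 + e14 + e24 + e34) =
    (-3 : ℤ) • ((A e02 e03 e04 - A e01 e03 e04 + A e01 e02 e04 - A e01 e02 e03) - (A e12 e13 e14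
      - A e01 e13 e14 + A e01 e12 e14 - A e01 e12 e13) + (A e12 e23 e24 - A e02 e23 e24 + A e02
      e12 e24 - A e02 e12 e23) - (A e13 e23 e34 - A e03 e23 e34 + A e03 e13 e34 - A e03 e13 e23) +
      (A e14 e24 e34 - A e04 e24 e34 + A e04 e14 e34 - A e04 e14 e24)) := by
  have add₂ : ∀ x y y' z, A x (y + y') z = A x y z + A x y' z := fun x y y' z => by
    rw [swap₁, add₁, swap₁ x, swap₁ x, neg_add]
  have add₃ : ∀ x y z z', A x y (z + z') = A x y z + A x y z' := fun x y z z' => by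
    rw [swap₂, add₂, swap₂ x y, swap₂ x y, neg_add]
  have sub₁ : ∀ x x' y z, A (x - x') y z = A x y z - A x' y z := fun x x' y z => by
    rw [eq_sub_iff_add_eq, ← add₁, sub_add_cancel]
  have sub₂ : ∀ x y y' z, A x (y - y') z = A x y z - A x y' z := fun x y y' z => by
    rw [eq_sub_iff_add_eq, ← add₂, sub_add_cancel]
  have s : ∀ x y z, A x y z = -A y x z := swap₁
  have t : ∀ x y z, A z x y = -A z y x := fun x y z => swap₂ z x y
  simp only [add₁, add₂, add₃, sub₁, sub₂, self₁]
  -- Only transpositions of pairs in the wrong order are listed, so rewriting terminates by sorting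
  -- the letters of each monomial.
  simp only [s e02 e01, s e03 e01, t e03 e01, t e04 e01, s e12 e01, s e13 e01, t e13 e01, t
    e14 e01, t e23 e01, s e24 e01, t e24 e01, s e34 e01, s e03 e02, t e03 e02, t e04 e02, s e12
    e02, s e13 e02, t e13 e02, s e14 e02, t e14 e02, s e23 e02, t e23 e02, s e24 e02, t e24 e02,
    s e34 e02, t e04 e03, s e12 e03, t e12 e03, s e13 e03, t e13 e03, s e14 e03, t e14 e03, s
    e23 e03, t e23 e03, s e24 e03, t e24 e03, s e34 e03, t e34 e03, s e12 e04, t e12 e04, s e13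
    e04, t e13 e04, s e14 e04, t e14 e04, s e23 e04, t e23 e04, s e24 e04, t e24 e04, s e34 e04,
    t e34 e04, s e13 e12, t e13 e12, s e14 e12, t e14 e12, s e23 e12, t e23 e12, s e24 e12, t
    e24 e12, s e34 e12, t e34 e12, s e14 e13, t e14 e13, s e23 e13, t e23 e13, s e24 e13, t e24
    e13, s e34 e13, t e34 e13, t e23 e14, s e24 e14, t e24 e14, s e34 e14, t e34 e14, t e24 e23,
    t e34 e23, t e34 e24]
  abel

end Rows

/-! ### Logarithms and the cyclic alternating form -/

/-- The logarithmic derivative of `x` together with the class of `x` in `F^×`. -/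
def logPair {F : Type*} [Field F] (D : Derivation ℤ F F) (x : F) : F × MulGroup F :=
  (dlog D x, unitOf x)

lemma logPair_mul {F : Type*} [Field F] (D : Derivation ℤ F F) {x y : F} (hx : x ≠ 0)
    (hy : y ≠ 0) : logPair D (x * y) = logPair D x + logPair D y :=
  Prod.ext (dlog_mul D hx hy) (unitOf_mul hx hy)

lemma logPair_div {F : Type*} [Field F] (D : Derivation ℤ F F) {x y : F} (hx : x ≠ 0)
    (hy : y ≠ 0) : logPair D (x / y) = logPair D x - logPair D y :=
  Prod.ext (dlog_div D hx hy) (unitOf_div hx hy)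

/-- The alternating trilinear form `x ⊗ (y ∧ z) + y ⊗ (z ∧ x) + z ⊗ (x ∧ y)`. -/
def cyclicWedge {F : Type*} [Field F] (x y z : F × MulGroup F) : F ⊗[ℤ] Wedge2 F :=
  x.1 ⊗ₜ[ℤ] wedgeBilin F y.2 z.2 + y.1 ⊗ₜ[ℤ] wedgeBilin F z.2 x.2 +
    z.1 ⊗ₜ[ℤ] wedgeBilin F x.2 y.2

lemma cyclicWedge_add {F : Type*} [Field F] (x x' y z : F × MulGroup F) :
    cyclicWedge (x + x') y z = cyclicWedge x y z + cyclicWedge x' y z := by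
  simp only [cyclicWedge, Prod.fst_add, Prod.snd_add, map_add, LinearMap.add_apply,
    TensorProduct.add_tmul, TensorProduct.tmul_add]
  abel

lemma cyclicWedge_swap₁ {F : Type*} [Field F] (x y z : F × MulGroup F) :
    cyclicWedge x y z = -cyclicWedge y x z := by
  simp only [cyclicWedge]
  rw [wedgeBilin_swap z.2 y.2, wedgeBilin_swap x.2 z.2, wedgeBilin_swap x.2 y.2]
  simp only [TensorProduct.tmul_neg]
  abel

lemma cyclicWedge_swap₂ {F : Type*} [Field F] (x y z : F × MulGroup F) :
    cyclicWedge x y z = -cyclicWedge x z y := by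
  simp only [cyclicWedge]
  rw [wedgeBilin_swap z.2 y.2, wedgeBilin_swap x.2 z.2, wedgeBilin_swap x.2 y.2]
  simp only [TensorProduct.tmul_neg]
  abel

lemma cyclicWedge_self {F : Type*} [Field F] (x y : F × MulGroup F) : cyclicWedge x x y = 0 := by
  simp only [cyclicWedge, wedgeBilin_self, TensorProduct.tmul_zero, add_zero]
  rw [wedgeBilin_swap x.2 y.2, TensorProduct.tmul_neg, neg_add_cancel]

/-! ### The right square -/

section SecondSquare

variable {F : Type*} [Field F] {V : Type*} [AddCommGroup V] [Module F V]
  [Fact (Module.finrank F V = 3)]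

/-- Expanding the wedges of quotients leaves terms `D log` of one determinant with the wedge of two
others; collecting those with the same three determinants gives `cyclicWedge`. In this form it can
be matched with `alternating_five`. -/
lemma tau0Val_eq (D : Derivation ℤ F F) (ω : VolumeForm F V) (l : Generic F V 4)
    {a b c d : F} (ha : omitVol ω l.1 0 = a) (hb : omitVol ω l.1 1 = b)
    (hc : omitVol ω l.1 2 = c) (hd : omitVol ω l.1 3 = d) :
    tau0Val D ω l.1 =
      cyclicWedge (logPair D b) (logPair D c) (logPair D d)
        - cyclicWedge (logPair D a) (logPair D c) (logPair D d)
        + cyclicWedge (logPair D a) (logPair D b) (logPair D d)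
        - cyclicWedge (logPair D a) (logPair D b) (logPair D c) := by
  have h0 := omitVol_ne_zero ω l
  have ha0 : a ≠ 0 := ha ▸ h0 0
  have hb0 : b ≠ 0 := hb ▸ h0 1
  have hc0 : c ≠ 0 := hc ▸ h0 2
  have hd0 : d ≠ 0 := hd ▸ h0 3
  simp only [tau0Val, Fin.sum_univ_four, ← wedgeBilin_apply, Fin.reduceAdd, zero_add, ha, hb, hc,
    hd, unitOf_div ha0 hb0, unitOf_div ha0 hd0, unitOf_div hb0 ha0,
    unitOf_div hb0 hc0, unitOf_div hc0 hb0,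
    unitOf_div hc0 hd0, unitOf_div hd0 ha0, unitOf_div hd0 hc0,
    cyclicWedge, logPair]
  generalize unitOf a = a0
  generalize unitOf b = a1
  generalize unitOf c = a2
  generalize unitOf d = a3
  simp only [map_sub, LinearMap.sub_apply, wedgeBilin_self,
    wedgeBilin_swap a2 a0, wedgeBilin_swap a3 a0, wedgeBilin_swap a3 a1, TensorProduct.tmul_sub,
    TensorProduct.tmul_neg, TensorProduct.tmul_zero]
  norm_num
  abel

lemma vol_swap₁ (ω : VolumeForm F V) (x y z : V) : vol ω y x z = -vol ω x y z := by
  obtain ⟨c, f, hf⟩ := vol_coord ω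
  rw [hf, hf]; ring

lemma vol_swap₂ (ω : VolumeForm F V) (x y z : V) : vol ω x z y = -vol ω x y z := by
  obtain ⟨c, f, hf⟩ := vol_coord ω
  rw [hf, hf]; ring

/-- The Plücker relation for the points projected from `x`. It makes `1 - r` a monomial in
determinants, so that its logarithm splits. -/
lemma one_sub_projRatio (ω : VolumeForm F V) {x : V} {y : Fin 4 → V}
    (h02 : vol ω x (y 0) (y 2) ≠ 0) (h13 : vol ω x (y 1) (y 3) ≠ 0) :
    1 - projRatio ω x y = (vol ω x (y 0) (y 1) * vol ω x (y 2) (y 3)) /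
      (vol ω x (y 0) (y 2) * vol ω x (y 1) (y 3)) := by
  rw [projRatio, eq_div_iff (mul_ne_zero h02 h13), sub_mul,
    div_mul_cancel₀ _ (mul_ne_zero h02 h13)]
  obtain ⟨c, f, hf⟩ := vol_coord ω
  simp only [hf]
  ring

lemma projRatio_ne_zero (ω : VolumeForm F V) (l : Generic F V 5) (i : Fin 5) :
    projRatio ω (l.1 i) (fun k => l.1 (i.succAbove k)) ≠ 0 := by
  have h : ∀ i : Fin 5, ∀ a b : Fin 4, a ≠ b →
      i ≠ i.succAbove a ∧ i ≠ i.succAbove b ∧ i.succAbove a ≠ i.succAbove b := by decide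
  have h' : ∀ a b : Fin 4, a ≠ b → vol ω (l.1 i) (l.1 (i.succAbove a)) (l.1 (i.succAbove b)) ≠
    0 :=
    fun a b hab => vol_ne_zero ω l (h i a b hab).1 (h i a b hab).2.1 (h i a b hab).2.2
  exact div_ne_zero (mul_ne_zero (h' _ _ (by decide)) (h' _ _ (by decide)))
    (mul_ne_zero (h' _ _ (by decide)) (h' _ _ (by decide)))

lemma projRatio_ne_one (ω : VolumeForm F V) (l : Generic F V 5) (i : Fin 5) :
    projRatio ω (l.1 i) (fun k => l.1 (i.succAbove k)) ≠ 1 := by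
  have h : ∀ i : Fin 5, ∀ a b : Fin 4, a ≠ b →
      i ≠ i.succAbove a ∧ i ≠ i.succAbove b ∧ i.succAbove a ≠ i.succAbove b := by decide
  have h' : ∀ a b : Fin 4, a ≠ b → vol ω (l.1 i) (l.1 (i.succAbove a)) (l.1 (i.succAbove b)) ≠
    0 :=
    fun a b hab => vol_ne_zero ω l (h i a b hab).1 (h i a b hab).2.1 (h i a b hab).2.2
  refine fun h1 => ?_
  have h2 := one_sub_projRatio ω (x := l.1 i) (y := fun k => l.1 (i.succAbove k))
    (h' 0 2 (by decide)) (h' 1 3 (by decide))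
  rw [h1, sub_self] at h2
  exact div_ne_zero (mul_ne_zero (h' _ _ (by decide)) (h' _ _ (by decide)))
    (mul_ne_zero (h' _ _ (by decide)) (h' _ _ (by decide))) h2.symm

lemma succAbove_four (i : Fin 4) (k : Fin 3) : i.succAbove k =
    (![![1, 2, 3], ![0, 2, 3], ![0, 1, 3], ![0, 1, 2]] : Fin 4 → Fin 3 → Fin 4) i k := by
  revert i k; decide

lemma sum_neg_one_pow_five {N : Type*} [AddCommGroup N] (g : Fin 5 → N) :
    ∑ i : Fin 5, (-1 : ℤ) ^ (i : ℕ) • g i = g 0 - g 1 + g 2 - g 3 + g 4 := by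
  rw [Fin.sum_univ_five]
  norm_num
  abel

lemma bdryMid_tau1Val [NeZero (2 : F)] [NeZero (3 : F)] (D : Derivation ℤ F F)
    (ω : VolumeForm F V) (l : Generic F V 5) :
    bdryMid D (tau1Val D ω l.1) =
      ∑ i : Fin 5, (-1 : ℤ) ^ (i : ℕ) • tau0Val D ω (face (m := 4) i l).1 := by
  obtain ⟨v, hv⟩ : ∃ v : Fin 5 → Fin 5 → Fin 5 → F,
      ∀ i j k, v i j k = vol ω (l.1 i) (l.1 j) (l.1 k) := ⟨_, fun _ _ _ => rfl⟩
  have w₁ : ∀ i j k, v j i k = -v i j k := fun i j k => by rw [hv, hv, ← vol_swap₁]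
  have w₂ : ∀ i j k, v i k j = -v i j k := fun i j k => by rw [hv, hv, ← vol_swap₂]
  have w₃ : ∀ i j k, v k i j = v i j k := fun i j k => by rw [w₁ i k j, w₂, neg_neg]
  have nz : ∀ i j k, i ≠ j → i ≠ k → j ≠ k → v i j k ≠ 0 := fun i j k h1 h2 h3 => by
    rw [hv]; exact vol_ne_zero ω l h1 h2 h3
  have n012 := nz 0 1 2 (by decide) (by decide) (by decide)
  have n013 := nz 0 1 3 (by decide) (by decide) (by decide)
  have n014 := nz 0 1 4 (by decide) (by decide) (by decide)
  have n023 := nz 0 2 3 (by decide) (by decide) (by decide)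
  have n024 := nz 0 2 4 (by decide) (by decide) (by decide)
  have n034 := nz 0 3 4 (by decide) (by decide) (by decide)
  have n123 := nz 1 2 3 (by decide) (by decide) (by decide)
  have n124 := nz 1 2 4 (by decide) (by decide) (by decide)
  have n134 := nz 1 3 4 (by decide) (by decide) (by decide)
  have n234 := nz 2 3 4 (by decide) (by decide) (by decide)
  have r0 : projRatio ω (l.1 0) (fun k => l.1 ((0 : Fin 5).succAbove k)) =
      (v 0 1 4 * v 0 2 3) / (v 0 1 3 * v 0 2 4) := by
    simp only [projRatio, ← hv, succAbove_five, Matrix.cons_val]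
  have o0 : 1 - projRatio ω (l.1 0) (fun k => l.1 ((0 : Fin 5).succAbove k)) =
      (v 0 1 2 * v 0 3 4) / (v 0 1 3 * v 0 2 4) := by
    rw [one_sub_projRatio ω (vol_ne_zero ω l (by decide) (by decide) (by decide))
      (vol_ne_zero ω l (by decide) (by decide) (by decide))]
    simp only [← hv, succAbove_five, Matrix.cons_val]
  have r1 : projRatio ω (l.1 1) (fun k => l.1 ((1 : Fin 5).succAbove k)) =
      (v 0 1 4 * v 1 2 3) / (v 0 1 3 * v 1 2 4) := by
    simp only [projRatio, ← hv, succAbove_five, Matrix.cons_val]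
    simp only [w₁ 0 1 3, w₁ 0 1 4, neg_mul, neg_neg, neg_div, div_neg]
  have o1 : 1 - projRatio ω (l.1 1) (fun k => l.1 ((1 : Fin 5).succAbove k)) =
      (v 0 1 2 * v 1 3 4) / (v 0 1 3 * v 1 2 4) := by
    rw [one_sub_projRatio ω (vol_ne_zero ω l (by decide) (by decide) (by decide))
      (vol_ne_zero ω l (by decide) (by decide) (by decide))]
    simp only [← hv, succAbove_five, Matrix.cons_val]
    simp only [w₁ 0 1 2, w₁ 0 1 3, neg_mul, neg_neg, neg_div, div_neg]
  have r2 : projRatio ω (l.1 2) (fun k => l.1 ((2 : Fin 5).succAbove k)) =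
      (v 0 2 4 * v 1 2 3) / (v 0 2 3 * v 1 2 4) := by
    simp only [projRatio, ← hv, succAbove_five, Matrix.cons_val]
    simp only [w₁ 0 2 3, w₁ 0 2 4, w₁ 1 2 3, w₁ 1 2 4, neg_mul, mul_neg, neg_neg]
  have o2 : 1 - projRatio ω (l.1 2) (fun k => l.1 ((2 : Fin 5).succAbove k)) =
      (v 0 1 2 * v 2 3 4) / (v 0 2 3 * v 1 2 4) := by
    rw [one_sub_projRatio ω (vol_ne_zero ω l (by decide) (by decide) (by decide))
      (vol_ne_zero ω l (by decide) (by decide) (by decide))]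
    simp only [← hv, succAbove_five, Matrix.cons_val]
    simp only [w₃ 0 1 2, w₁ 0 2 3, w₁ 1 2 4, neg_mul, mul_neg, neg_neg]
  have r3 : projRatio ω (l.1 3) (fun k => l.1 ((3 : Fin 5).succAbove k)) =
      (v 0 3 4 * v 1 2 3) / (v 0 2 3 * v 1 3 4) := by
    simp only [projRatio, ← hv, succAbove_five, Matrix.cons_val]
    simp only [w₃ 0 2 3, w₁ 0 3 4, w₃ 1 2 3, w₁ 1 3 4, neg_mul, mul_neg,
      neg_neg, neg_div, div_neg]
  have o3 : 1 - projRatio ω (l.1 3) (fun k => l.1 ((3 : Fin 5).succAbove k)) =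
      (v 0 1 3 * v 2 3 4) / (v 0 2 3 * v 1 3 4) := by
    rw [one_sub_projRatio ω (vol_ne_zero ω l (by decide) (by decide) (by decide))
      (vol_ne_zero ω l (by decide) (by decide) (by decide))]
    simp only [← hv, succAbove_five, Matrix.cons_val]
    simp only [w₃ 0 1 3, w₃ 0 2 3, w₁ 1 3 4, w₁ 2 3 4, mul_neg,
      neg_neg, neg_div, div_neg]
  have r4 : projRatio ω (l.1 4) (fun k => l.1 ((4 : Fin 5).succAbove k)) =
      (v 0 3 4 * v 1 2 4) / (v 0 2 4 * v 1 3 4) := by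
    simp only [projRatio, ← hv, succAbove_five, Matrix.cons_val]
    simp only [w₃ 0 2 4, w₃ 0 3 4, w₃ 1 2 4, w₃ 1 3 4]
  have o4 : 1 - projRatio ω (l.1 4) (fun k => l.1 ((4 : Fin 5).succAbove k)) =
      (v 0 1 4 * v 2 3 4) / (v 0 2 4 * v 1 3 4) := by
    rw [one_sub_projRatio ω (vol_ne_zero ω l (by decide) (by decide) (by decide))
      (vol_ne_zero ω l (by decide) (by decide) (by decide))]
    simp only [← hv, succAbove_five, Matrix.cons_val]
    simp only [w₃ 0 1 4, w₃ 0 2 4, w₃ 1 3 4, w₃ 2 3 4]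
  have p0 : omitProd ω l.1 0 = v 2 3 4 * v 1 3 4 * v 1 2 4 * v 1 2 3 := by
    simp only [omitProd, omitVol, Fin.prod_univ_four, succAbove_five, succAbove_four,
      Matrix.cons_val, hv]
  have p1 : omitProd ω l.1 1 = v 2 3 4 * v 0 3 4 * v 0 2 4 * v 0 2 3 := by
    simp only [omitProd, omitVol, Fin.prod_univ_four, succAbove_five, succAbove_four,
      Matrix.cons_val, hv]
  have p2 : omitProd ω l.1 2 = v 1 3 4 * v 0 3 4 * v 0 1 4 * v 0 1 3 := by
    simp only [omitProd, omitVol, Fin.prod_univ_four, succAbove_five, succAbove_four,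
      Matrix.cons_val, hv]
  have p3 : omitProd ω l.1 3 = v 1 2 4 * v 0 2 4 * v 0 1 4 * v 0 1 2 := by
    simp only [omitProd, omitVol, Fin.prod_univ_four, succAbove_five, succAbove_four,
      Matrix.cons_val, hv]
  have p4 : omitProd ω l.1 4 = v 1 2 3 * v 0 2 3 * v 0 1 3 * v 0 1 2 := by
    simp only [omitProd, omitVol, Fin.prod_univ_four, succAbove_five, succAbove_four,
      Matrix.cons_val, hv]
  -- The two components of a summand supply the three terms of the cyclic form; the minus sign of
  -- the second term is absorbed by reversing the wedge.
  have key : ∀ i : Fin 5, bdryMid D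
      (symb2 D (projRatio ω (l.1 i) fun k => l.1 (i.succAbove k)) ⊗ₜ[ℤ] unitOf (omitProd ω l.1 i),
      dlog D (omitProd ω l.1 i) ⊗ₜ[ℤ] symbB2 (projRatio ω (l.1 i) fun k => l.1 (i.succAbove k))) =
      cyclicWedge (logPair D (1 - projRatio ω (l.1 i) fun k => l.1 (i.succAbove k)))
        (logPair D (projRatio ω (l.1 i) fun k => l.1 (i.succAbove k)))
        (logPair D (omitProd ω l.1 i)) := fun i => by
    rw [bdryMid_apply D _ _ (projRatio_ne_zero ω l i) (projRatio_ne_one ω l i)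
      (projRatio_ne_zero ω l i) (projRatio_ne_one ω l i)]
    simp only [cyclicWedge, logPair, ← wedgeBilin_apply]
    rw [wedgeBilin_swap (unitOf (1 - _)), TensorProduct.tmul_neg, sub_neg_eq_add]
  have t0 := tau0Val_eq D ω (face (m := 4) 0 l) (a := v 2 3 4) (b := v 1 3 4) (c := v 1 2 4)
    (d := v 1 2 3)
    (by simp only [omitVol, face, succAbove_five, succAbove_four, Matrix.cons_val, hv])
    (by simp only [omitVol, face, succAbove_five, succAbove_four, Matrix.cons_val, hv])
    (by simp only [omitVol, face, succAbove_five, succAbove_four, Matrix.cons_val, hv])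
    (by simp only [omitVol, face, succAbove_five, succAbove_four, Matrix.cons_val, hv])
  have t1 := tau0Val_eq D ω (face (m := 4) 1 l) (a := v 2 3 4) (b := v 0 3 4) (c := v 0 2 4)
    (d := v 0 2 3)
    (by simp only [omitVol, face, succAbove_five, succAbove_four, Matrix.cons_val, hv])
    (by simp only [omitVol, face, succAbove_five, succAbove_four, Matrix.cons_val, hv])
    (by simp only [omitVol, face, succAbove_five, succAbove_four, Matrix.cons_val, hv])
    (by simp only [omitVol, face, succAbove_five, succAbove_four, Matrix.cons_val, hv])
  have t2 := tau0Val_eq D ω (face (m := 4) 2 l) (a := v 1 3 4) (b := v 0 3 4) (c := v 0 1 4)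
    (d := v 0 1 3)
    (by simp only [omitVol, face, succAbove_five, succAbove_four, Matrix.cons_val, hv])
    (by simp only [omitVol, face, succAbove_five, succAbove_four, Matrix.cons_val, hv])
    (by simp only [omitVol, face, succAbove_five, succAbove_four, Matrix.cons_val, hv])
    (by simp only [omitVol, face, succAbove_five, succAbove_four, Matrix.cons_val, hv])
  have t3 := tau0Val_eq D ω (face (m := 4) 3 l) (a := v 1 2 4) (b := v 0 2 4) (c := v 0 1 4)
    (d := v 0 1 2)
    (by simp only [omitVol, face, succAbove_five, succAbove_four, Matrix.cons_val, hv])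
    (by simp only [omitVol, face, succAbove_five, succAbove_four, Matrix.cons_val, hv])
    (by simp only [omitVol, face, succAbove_five, succAbove_four, Matrix.cons_val, hv])
    (by simp only [omitVol, face, succAbove_five, succAbove_four, Matrix.cons_val, hv])
  have t4 := tau0Val_eq D ω (face (m := 4) 4 l) (a := v 1 2 3) (b := v 0 2 3) (c := v 0 1 3)
    (d := v 0 1 2)
    (by simp only [omitVol, face, succAbove_five, succAbove_four, Matrix.cons_val, hv])
    (by simp only [omitVol, face, succAbove_five, succAbove_four, Matrix.cons_val, hv])
    (by simp only [omitVol, face, succAbove_five, succAbove_four, Matrix.cons_val, hv])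
    (by simp only [omitVol, face, succAbove_five, succAbove_four, Matrix.cons_val, hv])
  have k0 := key 0
  have k1 := key 1
  have k2 := key 2
  have k3 := key 3
  have k4 := key 4
  -- Only the right-hand side is expanded: the left-hand side must keep its cross-ratios to match
  -- `tau1Val`.
  conv_rhs at k0 => rw [o0, r0, p0, logPair_div D (mul_ne_zero n012 n034) (mul_ne_zero n013
    n024), logPair_mul D n012 n034, logPair_mul D n013 n024,
    logPair_div D (mul_ne_zero n014 n023) (mul_ne_zero n013 n024), logPair_mul D n014 n023,
      logPair_mul D n013 n024,
    logPair_mul D (mul_ne_zero (mul_ne_zero n234 n134) n124) n123, logPair_mul D (mul_ne_zero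
      n234 n134) n124, logPair_mul D n234 n134]
  conv_rhs at k1 => rw [o1, r1, p1, logPair_div D (mul_ne_zero n012 n134) (mul_ne_zero n013
    n124), logPair_mul D n012 n134, logPair_mul D n013 n124,
    logPair_div D (mul_ne_zero n014 n123) (mul_ne_zero n013 n124), logPair_mul D n014 n123,
      logPair_mul D n013 n124,
    logPair_mul D (mul_ne_zero (mul_ne_zero n234 n034) n024) n023, logPair_mul D (mul_ne_zero
      n234 n034) n024, logPair_mul D n234 n034]
  conv_rhs at k2 => rw [o2, r2, p2, logPair_div D (mul_ne_zero n012 n234) (mul_ne_zero n023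
    n124), logPair_mul D n012 n234, logPair_mul D n023 n124,
    logPair_div D (mul_ne_zero n024 n123) (mul_ne_zero n023 n124), logPair_mul D n024 n123,
      logPair_mul D n023 n124,
    logPair_mul D (mul_ne_zero (mul_ne_zero n134 n034) n014) n013, logPair_mul D (mul_ne_zero
      n134 n034) n014, logPair_mul D n134 n034]
  conv_rhs at k3 => rw [o3, r3, p3, logPair_div D (mul_ne_zero n013 n234) (mul_ne_zero n023
    n134), logPair_mul D n013 n234, logPair_mul D n023 n134,
    logPair_div D (mul_ne_zero n034 n123) (mul_ne_zero n023 n134), logPair_mul D n034 n123,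
      logPair_mul D n023 n134,
    logPair_mul D (mul_ne_zero (mul_ne_zero n124 n024) n014) n012, logPair_mul D (mul_ne_zero
      n124 n024) n014, logPair_mul D n124 n024]
  conv_rhs at k4 => rw [o4, r4, p4, logPair_div D (mul_ne_zero n014 n234) (mul_ne_zero n024
    n134), logPair_mul D n014 n234, logPair_mul D n024 n134,
    logPair_div D (mul_ne_zero n034 n124) (mul_ne_zero n024 n134), logPair_mul D n034 n124,
      logPair_mul D n024 n134,
    logPair_mul D (mul_ne_zero (mul_ne_zero n123 n023) n013) n012, logPair_mul D (mul_ne_zero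
      n123 n023) n013, logPair_mul D n123 n023]
  have five := alternating_five (cyclicWedge (F := F)) cyclicWedge_add cyclicWedge_swap₁
    cyclicWedge_swap₂ cyclicWedge_self (logPair D (v 2 3 4)) (logPair D (v 1 3 4)) (logPair D (v
      1 2 4)) (logPair D (v 1 2 3)) (logPair D (v 0 3 4)) (logPair D (v 0 2 4)) (logPair D (v 0 2
      3)) (logPair D (v 0 1 4)) (logPair D (v 0 1 3)) (logPair D (v 0 1 2))
  rw [← t0, ← t1, ← t2, ← t3, ← t4, ← k0, ← k1, ← k2, ← k3, ← k4] at five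
  have h3 : (-(1 / 3) : F) * ((-3 : ℤ) : F) = 1 := by
    have := NeZero.ne (3 : F)
    push_cast
    field_simp
  have five' := congrArg (fun z => (-(1 / 3) : F) • z) five
  simp only [← Int.cast_smul_eq_zsmul F (-3), smul_smul, h3, one_smul] at five'
  rw [tau1Val, map_smul, map_sum]
  simp only [map_zsmul]
  rw [sum_neg_one_pow_five, sum_neg_one_pow_five]
  exact five'

lemma bdryMid_comp_tau1 [NeZero (2 : F)] [NeZero (3 : F)] (D : Derivation ℤ F F)
    (ω : VolumeForm F V) :
    (bdryMid D).toAddMonoidHom.comp (tau1 D ω) = (tau0 D ω).comp (grassD F V 4) := by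
  refine chain_hom_ext (m := 5) fun l => ?_
  have h1 : tau1 D ω (conf l) = tau1Val D ω l.1 := chainLift_conf _ _ l
  have h0 : ∀ l : Generic F V 4, tau0 D ω (conf l) = tau0Val D ω l.1 := chainLift_conf _ _
  have h2 : tau0 D ω (grassD F V 4 (conf l)) =
      ∑ i : Fin 5, (-1 : ℤ) ^ (i : ℕ) • tau0Val D ω (face (m := 4) i l).1 := by
    refine (congrArg (tau0 D ω) (grassD_four_conf l)).trans ?_
    simp only [map_sum, map_zsmul, h0]
  exact (congrArg (bdryMid D) h1).trans ((bdryMid_tau1Val D ω l).trans h2.symm)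

end SecondSquare

/-! ### Consequences of the five-term relation -/

/-- Functions on `F` that satisfy the five-term relation of the cross-ratio. -/
structure FiveTermFunction {F : Type*} [Field F] {M : Type*} [AddCommGroup M] (f : F → M) :
    Prop where
  map_one : f 1 = 0
  sum_eq_zero : ∀ p : Fin 5 → Fin 2 → F, (∀ i j, i ≠ j → det2 (p i) (p j) ≠ 0) →
    ∑ i : Fin 5, (-1 : ℤ) ^ (i : ℕ) • f (crossRatio fun k => p (i.succAbove k)) = 0

namespace FiveTermFunction

variable {F : Type*} [Field F] {M : Type*} [AddCommGroup M] {f : F → M}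

lemma sum_five_points (hf : FiveTermFunction f) (p : Fin 5 → Fin 2 → F)
    (hp : ∀ i j, i < j → det2 (p i) (p j) ≠ 0) :
    f (crossRatio ![p 1, p 2, p 3, p 4]) - f (crossRatio ![p 0, p 2, p 3, p 4])
      + f (crossRatio ![p 0, p 1, p 3, p 4]) - f (crossRatio ![p 0, p 1, p 2, p 4])
      + f (crossRatio ![p 0, p 1, p 2, p 3]) = 0 := by
  have h := hf.sum_eq_zero p fun i j hij => by
    rcases lt_or_gt_of_ne hij with h | h
    · exact hp i j h
    · rw [det2_swap]
      exact neg_ne_zero.mpr (hp j i h)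
  rw [sum_neg_one_pow_five] at h
  simpa only [crossRatio, succAbove_five, Matrix.cons_val] using h

/-- The relation for the points `∞, 0, u, v, w` in this order. -/
lemma relation_zero_second (hf : FiveTermFunction f) {u v w : F} (hu : u ≠ 0) (hv : v ≠ 0)
    (hw : w ≠ 0) (huv : u ≠ v) (huw : u ≠ w) (hvw : v ≠ w) :
    f (w * (u - v) / (v * (u - w))) - f ((u - v) / (u - w)) + f (v / w) - f (u / w)
      + f (u / v) = 0 := by
  have huv' := sub_ne_zero.mpr huv
  have huw' := sub_ne_zero.mpr huw
  have hvw' := sub_ne_zero.mpr hvw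
  have h := hf.sum_five_points ![![1, 0], ![0, 1], ![u, 1], ![v, 1], ![w, 1]] (by
    intro i j hij
    fin_cases i <;> fin_cases j <;> first
      | exact absurd hij (by decide)
      | simp [det2, hu, hv, hw, huv', huw', hvw'])
  simpa only [crossRatio, det2, Matrix.cons_val, zero_mul, one_mul, mul_one, zero_sub, sub_zero,
    neg_mul, mul_neg, neg_div_neg_eq, inv_div, mul_zero] using h

/-- The relation for `∞, u, 0, v, w`: compared with `relation_zero_second`, the points `0` and `u`
trade places. -/
lemma relation_zero_third (hf : FiveTermFunction f) {u v w : F} (hu : u ≠ 0) (hv : v ≠ 0)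
    (hw : w ≠ 0) (huv : u ≠ v) (huw : u ≠ w) (hvw : v ≠ w) :
    f ((w * (u - v) / (v * (u - w)))⁻¹) - f (v / w) + f ((u - v) / (u - w)) - f (u / (u - w))
      + f (u / (u - v)) = 0 := by
  have e : (w * (u - v) / (v * (u - w)))⁻¹ = (u - w) * v / ((u - v) * w) := by
    rw [inv_div, mul_comm v, mul_comm w]
  rw [e]
  have huv' := sub_ne_zero.mpr huv
  have huw' := sub_ne_zero.mpr huw
  have hvw' := sub_ne_zero.mpr hvw
  have h := hf.sum_five_points ![![1, 0], ![u, 1], ![0, 1], ![v, 1], ![w, 1]] (by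
    intro i j hij
    fin_cases i <;> fin_cases j <;> first
      | exact absurd hij (by decide)
      | simp [det2, hu, hv, hw, huv', huw', hvw'])
  simpa only [crossRatio, det2, Matrix.cons_val, zero_mul, one_mul, mul_one, zero_sub, sub_zero,
    neg_mul, mul_neg, neg_div_neg_eq, inv_div, mul_zero] using h

variable [Module F M]

lemma eq_zero_of_nsmul (n : ℕ) (hn : (n : F) ≠ 0) {x : M} (h : n • x = 0) : x = 0 := by
  rw [← Nat.cast_smul_eq_nsmul F, smul_eq_zero] at h
  exact h.resolve_left hn

variable [NeZero (2 : F)] [NeZero (3 : F)]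

/-- One of `2` and `-1` works, as they are distinct when `3 ≠ 0`. -/
lemma exists_ne_zero_one (x : F) : ∃ y : F, y ≠ 0 ∧ y ≠ 1 ∧ y ≠ x := by
  have h2 := NeZero.ne (2 : F)
  have h3 := NeZero.ne (3 : F)
  by_cases hx : x = 2
  · refine ⟨-1, by simp, fun h => h2 ?_, fun h => h3 ?_⟩
    · linear_combination -h
    · linear_combination -h - hx
  · exact ⟨2, h2, fun h => one_ne_zero (α := F) (by linear_combination h), Ne.symm hx⟩

lemma map_inv (hf : FiveTermFunction f) {x : F} (hx : x ≠ 0) : f x⁻¹ = -f x := by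
  by_cases hx1 : x = 1
  · simp [hx1, hf.map_one]
  -- `h x = f x + f x⁻¹` satisfies `h (B q) = h B - h q`
  have key : ∀ B q : F, B ≠ 0 → B ≠ 1 → q ≠ 0 → q ≠ 1 → B * q ≠ 1 →
      f (B * q) + f (B * q)⁻¹ - (f B + f B⁻¹) + (f q + f q⁻¹) = 0 := by
    intro B q hB hB1 hq hq1 hBq
    have e1 : 1 - B ≠ 0 := sub_ne_zero.mpr (Ne.symm hB1)
    have e2 : 1 - B * q ≠ 0 := sub_ne_zero.mpr (Ne.symm hBq)
    have e3 : q - 1 ≠ 0 := sub_ne_zero.mpr hq1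
    -- The solution of `(u - 1) / (u - q) = B`. The relations for `(u, 1, q)` and `(u, q, 1)` are
    -- added, and the terms in `u` and `u / q` cancel.
    obtain ⟨u, hu⟩ : ∃ u, u = (1 - B * q) / (1 - B) := ⟨_, rfl⟩
    have u0 : u ≠ 0 := hu ▸ div_ne_zero e2 e1
    have u1' : u - 1 = B * (1 - q) / (1 - B) := by rw [hu]; field_simp; ring
    have uq' : u - q = (1 - q) / (1 - B) := by rw [hu]; field_simp; ring
    have e4 : 1 - q ≠ 0 := sub_ne_zero.mpr (Ne.symm hq1)
    have u1 : u - 1 ≠ 0 := u1' ▸ div_ne_zero (mul_ne_zero hB e4) e1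
    have uq : u - q ≠ 0 := uq' ▸ div_ne_zero e4 e1
    have r1 := hf.relation_zero_second u0 one_ne_zero hq (sub_ne_zero.mp u1) (sub_ne_zero.mp uq)
      (Ne.symm hq1)
    have r2 := hf.relation_zero_second u0 hq one_ne_zero (sub_ne_zero.mp uq) (sub_ne_zero.mp u1)
      hq1
    have a1 : (u - 1) / (u - q) = B := by rw [u1', uq']; field_simp
    have a2 : (u - q) / (u - 1) = B⁻¹ := by rw [← a1, inv_div]
    have a3 : q * (u - 1) / (1 * (u - q)) = B * q := by rw [one_mul, mul_div_assoc, a1, mul_comm]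
    have a4 : 1 * (u - q) / (q * (u - 1)) = (B * q)⁻¹ := by rw [← a3, inv_div]
    rw [a3, a1, one_div] at r1
    rw [a4, a2] at r2
    have r := congrArg₂ (· + ·) r1 r2
    simp only [add_zero, div_one] at r
    rw [← r]
    abel
  -- Factor `x = B * (x / B)`. Adding the relations for both orders of the factors leaves `2 h x =
  -- 0`.
  obtain ⟨B, hB, hB1, hBx⟩ := exists_ne_zero_one x
  have hq : x / B ≠ 0 := div_ne_zero hx hB
  have hq1 : x / B ≠ 1 := fun h => hBx ((div_eq_one_iff_eq hB).mp h).symm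
  have hm : B * (x / B) = x := mul_div_cancel₀ x hB
  have h1 := key B (x / B) hB hB1 hq hq1 (by rwa [hm])
  have h2 := key (x / B) B hq hq1 hB hB1 (by rwa [mul_comm, hm])
  rw [hm] at h1
  rw [mul_comm, hm] at h2
  have h3 : (2 : ℕ) • (f x⁻¹ + f x) = 0 := by
    have r := congrArg₂ (· + ·) h1 h2
    simp only [add_zero] at r
    rw [← r]
    abel
  exact eq_neg_of_add_eq_zero_left
    (eq_zero_of_nsmul (F := F) 2 (by exact_mod_cast NeZero.ne (2 : F)) h3)

lemma map_div_sub_one (hf : FiveTermFunction f) {x : F} (hx : x ≠ 0) (hx1 : x ≠ 1) :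
    f (x / (x - 1)) = -f x := by
  -- `f x + f (x / (x - 1))` is constant
  have key : ∀ x y : F, x ≠ 0 → x ≠ 1 → y ≠ 0 → y ≠ 1 →
      f x + f (x / (x - 1)) = f y + f (y / (y - 1)) := by
    intro x y hx hx1 hy hy1
    by_cases hxy : x = y
    · rw [hxy]
    have e1 : x - 1 ≠ 0 := sub_ne_zero.mpr hx1
    have e2 : y - 1 ≠ 0 := sub_ne_zero.mpr hy1
    have e1' : 1 - x ≠ 0 := sub_ne_zero.mpr (Ne.symm hx1)
    have e2' : 1 - y ≠ 0 := sub_ne_zero.mpr (Ne.symm hy1)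
    have n1 : (1 : F) ≠ x⁻¹ := fun h => hx1 (by rw [← inv_inv x, ← h, inv_one])
    have n2 : (1 : F) ≠ y⁻¹ := fun h => hy1 (by rw [← inv_inv y, ← h, inv_one])
    have n3 : x⁻¹ ≠ y⁻¹ := fun h => hxy (inv_injective h)
    -- With `u = 1`, `v = x⁻¹`, `w = y⁻¹` the terms that mix `x` and `y` cancel between the two
    -- relations, the first pair by inversion.
    have r1 := hf.relation_zero_second one_ne_zero (inv_ne_zero hx) (inv_ne_zero hy) n1 n2 n3
    have r2 := hf.relation_zero_third one_ne_zero (inv_ne_zero hx) (inv_ne_zero hy) n1 n2 n3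
    have hi := hf.map_inv (x := y⁻¹ * (1 - x⁻¹) / (x⁻¹ * (1 - y⁻¹)))
      (div_ne_zero (mul_ne_zero (inv_ne_zero hy) (sub_ne_zero.mpr n1))
        (mul_ne_zero (inv_ne_zero hx) (sub_ne_zero.mpr n2)))
    have a1 : 1 / (1 - x⁻¹) = x / (x - 1) := by
      have := sub_ne_zero.mpr n1
      field_simp
    have a2 : 1 / (1 - y⁻¹) = y / (y - 1) := by
      have := sub_ne_zero.mpr n2
      field_simp
    rw [hi, a1, a2] at r2
    rw [one_div, one_div, inv_inv, inv_inv] at r1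
    have r := congrArg₂ (· + ·) r1 r2
    simp only [add_zero] at r
    rw [← sub_eq_zero, ← r]
    abel
  have e1 : x - 1 ≠ 0 := sub_ne_zero.mpr hx1
  have e2 : 1 - x ≠ 0 := sub_ne_zero.mpr (Ne.symm hx1)
  -- Let `c` be the constant. Its values at `x⁻¹` and `1 - x` are `-f x - f (1 - x)` and `f (1 - x)
  -- - f (x / (x - 1))`, with sum `-c`; hence `3 c = 0`.
  have k1 := key x⁻¹ x (inv_ne_zero hx) (fun h => hx1 (by rw [← inv_inv x, h, inv_one])) hx hx1
  have k2 := key (1 - x) x e2 (fun h => hx (by linear_combination -h)) hx hx1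
  have a1 : x⁻¹ / (x⁻¹ - 1) = (1 - x)⁻¹ := by
    have : x⁻¹ - 1 ≠ 0 := by
      rw [sub_ne_zero]; exact fun h => hx1 (by rw [← inv_inv x, h, inv_one])
    field_simp
  have a2 : (1 - x) / (1 - x - 1) = (x / (x - 1))⁻¹ := by
    rw [inv_div, ← neg_div_neg_eq]; congr 1 <;> ring
  rw [a1, hf.map_inv hx, hf.map_inv e2] at k1
  rw [a2, hf.map_inv (div_ne_zero hx e1)] at k2
  have h3 : (3 : ℕ) • (f (x / (x - 1)) + f x) = 0 := by
    have r := congrArg₂ (· + ·) k1 k2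
    rw [← sub_eq_zero] at r
    rw [← neg_eq_zero, ← r]
    abel
  exact eq_neg_of_add_eq_zero_left
    (eq_zero_of_nsmul (F := F) 3 (by exact_mod_cast NeZero.ne (3 : F)) h3)

end FiveTermFunction

/-! ### Cross-ratios of projected points -/

section Projected

variable {F : Type*} [Field F] {V : Type*} [AddCommGroup V] [Module F V]
  [Fact (Module.finrank F V = 3)] (ω : VolumeForm F V)

lemma vol_plucker (x a b c d : V) :
    vol ω x a c * vol ω x b d - vol ω x b c * vol ω x a d = vol ω x a b * vol ω x c d := by
  obtain ⟨c, f, hf⟩ := vol_coord ω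
  simp only [hf]
  ring

lemma projRatio_swap₀₁ (x a b c d : V) :
    projRatio ω x ![b, a, c, d] = (projRatio ω x ![a, b, c, d])⁻¹ := by
  simp only [projRatio, Matrix.cons_val, inv_div]
  congr 1 <;> exact mul_comm _ _

lemma projRatio_swap₂₃ (x a b c d : V) :
    projRatio ω x ![a, b, d, c] = (projRatio ω x ![a, b, c, d])⁻¹ := by
  simp only [projRatio, Matrix.cons_val, inv_div]

lemma projRatio_swap₁₂ {x a b c d : V} (hac : vol ω x a c ≠ 0) (hbd : vol ω x b d ≠ 0)
    (hab : vol ω x a b ≠ 0) (hcd : vol ω x c d ≠ 0) :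
    projRatio ω x ![a, c, b, d] =
      projRatio ω x ![a, b, c, d] / (projRatio ω x ![a, b, c, d] - 1) := by
  have h : projRatio ω x ![a, b, c, d] - 1 =
      -((vol ω x a b * vol ω x c d) / (vol ω x a c * vol ω x b d)) := by
    rw [← neg_sub, one_sub_projRatio ω hac hbd]
    rfl
  rw [h]
  simp only [projRatio, Matrix.cons_val, vol_swap₂ ω x b c]
  field_simp

variable {M : Type*} [AddCommGroup M] {f : F → M}

/-- The value of a function on `F` at a projected cross-ratio. -/
def projVal (f : F → M) (x a b c d : V) : M := f (projRatio ω x ![a, b, c, d])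

/-- The last two points may have the same projection from `x`; this is needed later for an
intersection point about which nothing more is known. In that case the three ratios containing both
are `1`, where `f` vanishes, and the other two terms cancel. -/
lemma FiveTermFunction.sum_projVal (hf : FiveTermFunction f) (x : V) (z : Fin 5 → V)
    (hz : ∀ i j, i < j → (i, j) ≠ (3, 4) → vol ω x (z i) (z j) ≠ 0) :
    projVal ω f x (z 1) (z 2) (z 3) (z 4) - projVal ω f x (z 0) (z 2) (z 3) (z 4)
      + projVal ω f x (z 0) (z 1) (z 3) (z 4) - projVal ω f x (z 0) (z 1) (z 2) (z 4)
      + projVal ω f x (z 0) (z 1) (z 2) (z 3) = 0 := by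
  have n01 := hz 0 1 (by decide) (by decide)
  by_cases h34 : vol ω x (z 3) (z 4) = 0
  · have h1 : ∀ i j : Fin 5, i < 3 → j < 3 → projVal ω f x (z i) (z j) (z 3) (z 4) = 0 := by
      intro i j hi hj
      have n1 := hz i 3 hi (fun h => by simp_all)
      have n2 := hz j 4 (hj.trans (by decide)) (fun h => by simp_all)
      have h := one_sub_projRatio ω (x := x) (y := ![z i, z j, z 3, z 4]) n1 n2
      simp only [Matrix.cons_val, h34, mul_zero, zero_div] at h
      rw [projVal, ← sub_eq_zero.mp h, hf.map_one]
    rw [h1 1 2 (by decide) (by decide), h1 0 2 (by decide) (by decide),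
      h1 0 1 (by decide) (by decide)]
    have n02 := hz 0 2 (by decide) (by decide)
    have n13 := hz 1 3 (by decide) (by decide)
    have n14 := hz 1 4 (by decide) (by decide)
    have h := vol_plucker ω x (z 0) (z 1) (z 3) (z 4)
    rw [h34, mul_zero] at h
    have e : projRatio ω x ![z 0, z 1, z 2, z 4] = projRatio ω x ![z 0, z 1, z 2, z 3] := by
      simp only [projRatio, Matrix.cons_val]
      rw [div_eq_div_iff (mul_ne_zero n02 n14) (mul_ne_zero n02 n13)]
      linear_combination (-(vol ω x (z 1) (z 2) * vol ω x (z 0) (z 2))) * h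
    rw [projVal, projVal, e]
    abel
  -- Coordinates on the projective line of directions at `x`. By `vol_plucker` their `2 × 2`
  -- determinants are the projected ones up to the common factor `vol ω x (z 0) (z 1)`, which
  -- cancels in cross-ratios.
  · obtain ⟨p, hp⟩ : ∃ p : Fin 5 → Fin 2 → F,
        p = fun k => ![vol ω x (z 0) (z k), vol ω x (z 1) (z k)] := ⟨_, rfl⟩
    have hd : ∀ i j, det2 (p i) (p j) = vol ω x (z 0) (z 1) * vol ω x (z i) (z j) := by
      intro i j
      rw [← vol_plucker, hp]
      rfl
    have h := hf.sum_five_points p (by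
      intro i j hij
      rw [hd]
      refine mul_ne_zero n01 ?_
      by_cases h : (i, j) = (3, 4)
      · rw [Prod.mk.injEq] at h
        rw [h.1, h.2]
        exact h34
      · exact hz i j hij h)
    have e : ∀ a b c d, crossRatio ![p a, p b, p c, p d] =
        projRatio ω x ![z a, z b, z c, z d] := by
      intro a b c d
      have e' : ∀ r s t u v : F, r ≠ 0 →
          r * s * (r * t) / (r * u * (r * v)) = s * t / (u * v) := fun r s t u v hr => by
        rw [mul_mul_mul_comm r s, mul_mul_mul_comm r u, mul_div_mul_left _ _ (mul_ne_zero hr hr)]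
      simp only [crossRatio, projRatio, Matrix.cons_val, hd, e' _ _ _ _ _ n01]
    simpa only [e, projVal] using h

end Projected

/-! ### Five-term relations among six vectors -/

section Reindex

variable {F : Type*} [Field F] {V : Type*} [AddCommGroup V] [Module F V]

/-- Selecting vectors from a tuple in generic position. -/
def reindex {m n : ℕ} (l : Generic F V n) (e : Fin m → Fin n) (he : Function.Injective e) :
    Generic F V m :=
  ⟨fun k => l.1 (e k), fun s hs => by
    refine LinearIndepOn.comp_of_image (f := e) ?_ he.injOn
    have := l.2 (s.map ⟨e, he⟩) (by simpa using hs)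
    simpa using this⟩

/-- Permuting a tuple in generic position. -/
def permute {n : ℕ} (l : Generic F V n) (σ : Equiv.Perm (Fin n)) : Generic F V n :=
  reindex l σ σ.injective

variable [Fact (Module.finrank F V = 3)] (ω : VolumeForm F V)
variable {M : Type*} [AddCommGroup M] {f : F → M}

lemma FiveTermFunction.sum_dual (hf : FiveTermFunction f) (l : Generic F V 5) :
    projVal ω f (l.1 0) (l.1 1) (l.1 2) (l.1 3) (l.1 4)
      - projVal ω f (l.1 1) (l.1 0) (l.1 2) (l.1 3) (l.1 4)
      + projVal ω f (l.1 2) (l.1 0) (l.1 1) (l.1 3) (l.1 4)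
      - projVal ω f (l.1 3) (l.1 0) (l.1 1) (l.1 2) (l.1 4)
      + projVal ω f (l.1 4) (l.1 0) (l.1 1) (l.1 2) (l.1 3) = 0 := by
  obtain ⟨p, hp, h⟩ := exists_dual ω l
  have h5 := hf.sum_eq_zero p hp
  simp only [← h] at h5
  rw [sum_neg_one_pow_five] at h5
  simpa only [projVal, projRatio, succAbove_five, Matrix.cons_val] using h5

/-- The value of a function on `F` at the cross-ratio of `y_a, …, y_d` projected from `y_i`. -/
def ratioVal (f : F → M) (i a b c d : Fin 6) (y : Generic F V 6) : M :=
  projVal ω f (y.1 i) (y.1 a) (y.1 b) (y.1 c) (y.1 d)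

lemma nodup_five {i a b c d : Fin 6} (h : [i, a, b, c, d].Nodup) :
    i ≠ a ∧ i ≠ b ∧ i ≠ c ∧ i ≠ d ∧ a ≠ b ∧ a ≠ c ∧ a ≠ d ∧ b ≠ c ∧ b ≠ d ∧ c ≠ d := by
  simp only [List.nodup_cons, List.mem_cons, List.not_mem_nil, or_false, not_or] at h
  tauto

variable [NeZero (2 : F)] [NeZero (3 : F)] [Module F M]

lemma FiveTermFunction.ratioVal_swap₀₁ (hf : FiveTermFunction f) {i a b c d : Fin 6}
    (h : [i, a, b, c, d].Nodup) (y : Generic F V 6) :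
    ratioVal ω f i b a c d y = -ratioVal ω f i a b c d y := by
  obtain ⟨hia, hib, hic, hid, hab, hac, had, hbc, hbd, hcd⟩ := nodup_five h
  rw [ratioVal, projVal, projRatio_swap₀₁, hf.map_inv]
  · rfl
  · exact div_ne_zero (mul_ne_zero (vol_ne_zero ω y hia hid had) (vol_ne_zero ω y hib hic hbc))
      (mul_ne_zero (vol_ne_zero ω y hia hic hac) (vol_ne_zero ω y hib hid hbd))

lemma FiveTermFunction.ratioVal_swap₂₃ (hf : FiveTermFunction f) {i a b c d : Fin 6}
    (h : [i, a, b, c, d].Nodup) (y : Generic F V 6) :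
    ratioVal ω f i a b d c y = -ratioVal ω f i a b c d y := by
  obtain ⟨hia, hib, hic, hid, hab, hac, had, hbc, hbd, hcd⟩ := nodup_five h
  rw [ratioVal, projVal, projRatio_swap₂₃, hf.map_inv]
  · rfl
  · exact div_ne_zero (mul_ne_zero (vol_ne_zero ω y hia hid had) (vol_ne_zero ω y hib hic hbc))
      (mul_ne_zero (vol_ne_zero ω y hia hic hac) (vol_ne_zero ω y hib hid hbd))

/-- Exchanging the middle points turns `r` into `r / (r - 1)`. With the two outer transpositions,
which invert `r`, this makes `ratioVal` alternating in its four points. -/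
lemma FiveTermFunction.ratioVal_swap₁₂ (hf : FiveTermFunction f) {i a b c d : Fin 6}
    (h : [i, a, b, c, d].Nodup) (y : Generic F V 6) :
    ratioVal ω f i a c b d y = -ratioVal ω f i a b c d y := by
  obtain ⟨hia, hib, hic, hid, hab, hac, had, hbc, hbd, hcd⟩ := nodup_five h
  have nac := vol_ne_zero ω y hia hic hac
  have nbd := vol_ne_zero ω y hib hid hbd
  have nab := vol_ne_zero ω y hia hib hab
  have ncd := vol_ne_zero ω y hic hid hcd
  rw [ratioVal, projVal, projRatio_swap₁₂ ω nac nbd nab ncd, hf.map_div_sub_one]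
  · rfl
  · exact div_ne_zero (mul_ne_zero (vol_ne_zero ω y hia hid had) (vol_ne_zero ω y hib hic hbc))
      (mul_ne_zero nac nbd)
  · intro h1
    have h2 := one_sub_projRatio ω (x := y.1 i) (y := ![y.1 a, y.1 b, y.1 c, y.1 d]) nac nbd
    rw [h1, sub_self] at h2
    exact div_ne_zero (mul_ne_zero nab ncd) (mul_ne_zero nac nbd) h2.symm

/-- The five-term relation that connects two triple-ratios through the intersection point of the
lines `y_1 y_4` and `y_2 y_5`. -/
lemma FiveTermFunction.tripleRatio_relation (hf : FiveTermFunction f) (y : Generic F V 6) :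
    f (tripleRatio ω y.1) =
      f (tripleRatio ω (permute y (Equiv.swap 1 4)).1)
      + f ((vol ω (y.1 0) (y.1 1) (y.1 3) * vol ω (y.1 2) (y.1 5) (y.1 4)) /
          (vol ω (y.1 2) (y.1 5) (y.1 1) * vol ω (y.1 0) (y.1 4) (y.1 3)))
      - ratioVal ω f 0 1 4 2 3 y + ratioVal ω f 2 1 4 0 5 y := by
  obtain ⟨v, hv⟩ : ∃ v : Fin 6 → Fin 6 → Fin 6 → F,
      ∀ i j k, vol ω (y.1 i) (y.1 j) (y.1 k) = v i j k := ⟨_, fun _ _ _ => rfl⟩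
  have w₁ : ∀ i j k, v j i k = -v i j k := fun i j k => by rw [← hv, ← hv, ← vol_swap₁]
  have w₂ : ∀ i j k, v i k j = -v i j k := fun i j k => by rw [← hv, ← hv, ← vol_swap₂]
  have nz : ∀ i j k, i ≠ j → i ≠ k → j ≠ k → v i j k ≠ 0 := fun i j k h1 h2 h3 => by
    rw [← hv]; exact vol_ne_zero ω y h1 h2 h3
  -- The coefficients make `Δ(y_2, y_5, m)` vanish, so `m` represents the intersection of the lines
  -- `y_1 y_4` and `y_2 y_5`.
  obtain ⟨m, hm⟩ : ∃ m, m = v 2 5 4 • y.1 1 - v 2 5 1 • y.1 4 := ⟨_, rfl⟩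
  have lin : ∀ a b, vol ω a b m = v 2 5 4 * vol ω a b (y.1 1) - v 2 5 1 * vol ω a b (y.1 4) := by
    intro a b
    have h : ∀ c, vol ω a b c = ω.1 (Function.update ![a, b, 0] 2 c) := fun c => by
      rw [vol]
      congr 1
      ext k
      fin_cases k <;> rfl
    rw [h, h, h, hm, AlternatingMap.map_update_sub, AlternatingMap.map_update_smul,
      AlternatingMap.map_update_smul, smul_eq_mul, smul_eq_mul]
  have self : ∀ a b, vol ω a b b = 0 := fun a b => by
    obtain ⟨c, f, hf⟩ := vol_coord ω
    rw [hf]; ring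
  have m1 : vol ω (y.1 0) (y.1 1) m = -(v 2 5 1 * v 0 1 4) := by
    rw [lin, self, hv]; ring
  have m4 : vol ω (y.1 0) (y.1 4) m = -(v 2 5 4 * v 0 1 4) := by
    rw [lin, self, hv, w₂ 0 1 4]; ring
  have m2 : vol ω (y.1 0) (y.1 2) m = v 0 2 5 * v 2 1 4 := by
    rw [lin, ← hv, ← hv, ← hv, ← hv]
    obtain ⟨c, f, hf⟩ := vol_coord ω
    simp only [hf]
    ring
  have n (i j k) (h : i ≠ j ∧ i ≠ k ∧ j ≠ k) : v i j k ≠ 0 := nz i j k h.1 h.2.1 h.2.2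
  have n013 := n 0 1 3 (by decide)
  have n014 := n 0 1 4 (by decide)
  have n012 := n 0 1 2 (by decide)
  have n024 := n 0 2 4 (by decide)
  have n025 := n 0 2 5 (by decide)
  have n023 := n 0 2 3 (by decide)
  have n034 := n 0 3 4 (by decide)
  have n124 := n 1 2 4 (by decide)
  have n125 := n 1 2 5 (by decide)
  have n245 := n 2 4 5 (by decide)
  have s043 := w₂ 0 3 4
  have s042 := w₂ 0 2 4
  have s041 := w₂ 0 1 4
  have s214 := w₁ 1 2 4
  have s205 := w₁ 0 2 5
  have s203 := w₁ 0 2 3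
  have s201 : v 2 0 1 = v 0 1 2 := by rw [w₁ 0 2 1, w₂ 0 1 2, neg_neg]
  have s210 : v 2 1 0 = -v 0 1 2 := by rw [w₂ 2 0 1, s201]
  have s215 := w₁ 1 2 5
  have s251 : v 2 5 1 = v 1 2 5 := by rw [w₂ 2 1 5, s215, neg_neg]
  have s254 := w₂ 2 4 5
  have s240 : v 2 4 0 = v 0 2 4 := by rw [w₂ 2 0 4, w₁ 0 2 4, neg_neg]
  have s421 : v 4 2 1 = -v 1 2 4 := by rw [w₁ 2 4 1, w₂ 2 1 4, s214, neg_neg]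
  have s425 : v 4 2 5 = -v 2 4 5 := by rw [w₁ 2 4 5]
  -- `m` and `y_3` come last since they may be collinear with `y_0`, the degeneracy that
  -- `sum_projVal` permits.
  have h := hf.sum_projVal ω (y.1 0) ![y.1 1, y.1 4, y.1 2, m, y.1 3] (by
    intro i j hij hne
    fin_cases i <;> fin_cases j <;> first
      | exact absurd hij (by decide)
      | exact absurd rfl hne
      | simp [hv, m1, m2, m4, s043, s042, s214, s251, s254, n013, n014, n012, n024, n025,
          n023, n034, n124, n125, n245])
  simp only [Matrix.cons_val] at h
  have p0 : (permute y (Equiv.swap 1 4)).1 = ![y.1 0, y.1 4, y.1 2, y.1 3, y.1 1, y.1 5] := by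
    ext k
    fin_cases k <;> rfl
  have e1 : projVal ω f (y.1 0) (y.1 4) (y.1 2) m (y.1 3) =
      f (tripleRatio ω (permute y (Equiv.swap 1 4)).1) := by
    rw [projVal, p0]
    congr 1
    simp only [projRatio, tripleRatio, Matrix.cons_val, hv, m2, m4, s043, s041, s214, s254, s205, s203,
      s421, s425]
    field_simp
  have e2 : projVal ω f (y.1 0) (y.1 1) (y.1 2) m (y.1 3) = f (tripleRatio ω y.1) := by
    rw [projVal]
    congr 1
    simp only [projRatio, tripleRatio, Matrix.cons_val, hv, m1, m2, s214, s251, s205, s203]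
    field_simp
  have e3 : projVal ω f (y.1 0) (y.1 1) (y.1 4) m (y.1 3) =
      f ((vol ω (y.1 0) (y.1 1) (y.1 3) * vol ω (y.1 2) (y.1 5) (y.1 4)) /
          (vol ω (y.1 2) (y.1 5) (y.1 1) * vol ω (y.1 0) (y.1 4) (y.1 3))) := by
    rw [projVal]
    congr 1
    simp only [projRatio, Matrix.cons_val, hv, m1, m4, s043, s251, s254]
    field_simp
  -- Both are the cross-ratio, on the line `y_1 y_4`, of `y_1`, `y_4`, the intersection with `y_0
  -- y_2`, and `m`, seen from `y_0` and from `y_2`.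
  have e4 : projVal ω f (y.1 0) (y.1 1) (y.1 4) (y.1 2) m = ratioVal ω f 2 1 4 0 5 y := by
    rw [projVal, ratioVal, projVal]
    congr 1
    simp only [projRatio, Matrix.cons_val, hv, m1, m4, s042, s251, s254, s215, s240, s210]
    field_simp
  rw [e1, e2, e3, e4] at h
  rw [← sub_eq_zero, ← neg_eq_zero, ← h, ratioVal]
  abel

end Reindex

/-- Laplace-type expansion: permutations are grouped by the image of `0`, and the remaining indices
are listed in increasing order. Iterating it turns a sum over `S_6` into sums over faces. -/
lemma sum_perm_succ {X N : Type*} [AddCommGroup N] {n : ℕ} (G : (Fin (n + 1) → X) → N)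
    (l : Fin (n + 1) → X) :
    ∑ σ : Equiv.Perm (Fin (n + 1)), (Equiv.Perm.sign σ : ℤ) • G (fun k => l (σ k)) =
      ∑ i : Fin (n + 1), (-1 : ℤ) ^ (i : ℕ) • ∑ τ : Equiv.Perm (Fin n),
        (Equiv.Perm.sign τ : ℤ) • G (Fin.cons (l i) fun k => l (i.succAbove (τ k))) := by
  rw [Finset.univ_perm_fin_succ, ← Finset.univ_product_univ]
  simp only [Finset.sum_map, Equiv.toEmbedding_apply, Finset.sum_product]
  refine Finset.sum_congr rfl fun i _ => ?_
  have hG : ∀ τ : Equiv.Perm (Fin n),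
      (fun k => l (Equiv.Perm.decomposeFin.symm (i, τ) k)) =
        Fin.cons (l i) (fun k => l (Equiv.swap 0 i (τ k).succ)) := fun τ => by
    ext k
    refine Fin.cases ?_ (fun k => ?_) k
    · simp only [Equiv.Perm.decomposeFin_symm_apply_zero, Fin.cons_zero]
    · simp only [Equiv.Perm.decomposeFin_symm_apply_succ, Fin.cons_succ]
  simp only [hG]
  revert hG
  refine Fin.cases (fun _ => ?_) (fun i _ => ?_) i
  · simp [Equiv.Perm.decomposeFin.symm_sign]
  · symm
    -- `decomposeFin` lists the remaining indices through a transposition instead of in increasing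
    -- order; the two lists differ by `cycleRange`, whose sign contributes `(-1)^i`.
    rw [Finset.smul_sum, ← Equiv.sum_comp (Equiv.mulLeft i.cycleRange)]
    refine Finset.sum_congr rfl fun τ _ => ?_
    rw [smul_smul]
    congr 1
    · simp only [Equiv.Perm.decomposeFin.symm_sign, if_neg (Fin.succ_ne_zero i), Equiv.coe_mulLeft,
        Equiv.Perm.sign_mul, Fin.sign_cycleRange, Fin.val_succ, pow_succ]
      push_cast
      have h : (-1 : ℤ) ^ (i : ℕ) * (-1) ^ (i : ℕ) = 1 := by rw [← mul_pow]; simp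
      linear_combination (-((Equiv.Perm.sign τ : ℤˣ) : ℤ)) * h
    · simp only [Equiv.coe_mulLeft, Equiv.Perm.mul_apply, Fin.succAbove_cycleRange]

lemma sum_perm_three {X N : Type*} [AddCommGroup N] (H : X → X → X → N) (l : Fin 3 → X) :
    ∑ σ : Equiv.Perm (Fin 3), (Equiv.Perm.sign σ : ℤ) • H (l (σ 0)) (l (σ 1)) (l (σ 2)) =
      H (l 0) (l 1) (l 2) - H (l 0) (l 2) (l 1) - H (l 1) (l 0) (l 2) + H (l 1) (l 2) (l 0)
        + H (l 2) (l 0) (l 1) - H (l 2) (l 1) (l 0) := by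
  have h1 := sum_perm_succ (fun y : Fin 3 → X => H (y 0) (y 1) (y 2)) l
  have h2 : ∀ i : Fin 3, _ := fun i => sum_perm_succ
    (fun y : Fin 2 → X => H (l i) (y 0) (y 1)) (fun k => l (i.succAbove k))
  have r : ∀ (i : Fin 3) (k : Fin 2), i.succAbove k =
    (![![1, 2], ![0, 2], ![0, 1]] : Fin 3 → Fin 2 → Fin 3) i k := by decide
  have r' : ∀ (i : Fin 2) (k : Fin 1), i.succAbove k =
    (![![1], ![0]] : Fin 2 → Fin 1 → Fin 2) i k := by decide
  refine h1.trans ?_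
  refine (Finset.sum_congr rfl fun (i : Fin 3) _ =>
    congrArg (((-1 : ℤ) ^ (i : ℕ)) • ·) (h2 i)).trans ?_
  simp [Fin.sum_univ_three, Fin.sum_univ_two, r, r']
  abel

/-- Pairings of a group with `F^×` that are additive in the logarithmic argument. -/
structure LogPairing {F : Type*} [Field F] {M N : Type*} [AddCommGroup M] [AddCommGroup N]
    (ψ : F → M →+ N) : Prop where
  map_mul : ∀ {x y : F}, x ≠ 0 → y ≠ 0 → ψ (x * y) = ψ x + ψ y

/-! ### Alternating sums weighted by a determinant -/

section Alternation

variable {F : Type*} [Field F] {V : Type*} [AddCommGroup V] [Module F V]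
variable {M N : Type*} [AddCommGroup M] [AddCommGroup N]

/-- The alternating sum of a function of six vectors over their permutations. -/
def alternation (G : Generic F V 6 → N) (l : Generic F V 6) : N :=
  ∑ σ : Equiv.Perm (Fin 6), (Equiv.Perm.sign σ : ℤ) • G (permute l σ)

/-- Substitution of `σ * π` for `σ` in the sum. -/
lemma alternation_permute (G : Generic F V 6 → N) (l : Generic F V 6)
    (π : Equiv.Perm (Fin 6)) :
    alternation (fun y => G (permute y π)) l = (Equiv.Perm.sign π : ℤ) • alternation G l := by
  rw [alternation, alternation, ← Equiv.sum_comp (Equiv.mulRight π) (fun σ : Equiv.Perm (Fin 6) =>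
    (Equiv.Perm.sign σ : ℤ) • G (permute l σ)), Finset.smul_sum]
  refine Finset.sum_congr rfl fun σ _ => ?_
  have h : ((Equiv.Perm.sign π : ℤˣ) : ℤ) * ((Equiv.Perm.sign π : ℤˣ) : ℤ) = 1 := by
    rw [← Units.val_mul, Int.units_mul_self, Units.val_one]
  rw [smul_smul, Equiv.coe_mulRight, Equiv.Perm.sign_mul, Units.val_mul]
  have e : ((Equiv.Perm.sign π : ℤˣ) : ℤ) * (((Equiv.Perm.sign σ : ℤˣ) : ℤ) *
      ((Equiv.Perm.sign π : ℤˣ) : ℤ)) = ((Equiv.Perm.sign σ : ℤˣ) : ℤ) := by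
    linear_combination ((Equiv.Perm.sign σ : ℤˣ) : ℤ) * h
  rw [e]
  rfl

lemma alternation_add (G H : Generic F V 6 → N) (l : Generic F V 6) :
    alternation (fun y => G y + H y) l = alternation G l + alternation H l := by
  simp only [alternation, smul_add, Finset.sum_add_distrib]

lemma alternation_neg (G : Generic F V 6 → N) (l : Generic F V 6) :
    alternation (fun y => -G y) l = -alternation G l := by
  simp only [alternation, smul_neg, Finset.sum_neg_distrib]

lemma alternation_sub (G H : Generic F V 6 → N) (l : Generic F V 6) :
    alternation (fun y => G y - H y) l = alternation G l - alternation H l := by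
  simp only [alternation, smul_sub, Finset.sum_sub_distrib]

lemma alternation_zero (l : Generic F V 6) : alternation (fun _ => (0 : N)) l = 0 := by
  simp only [alternation, smul_zero, Finset.sum_const_zero]

variable [Fact (Module.finrank F V = 3)] (ω : VolumeForm F V)

/-- The alternating sum of the pairings of a function `H` with `Δ(y_0, y_2, y_5)`. -/
def weighted (ψ : F → M →+ N) (H : Generic F V 6 → M) (l : Generic F V 6) : N :=
  alternation (fun y => ψ (vol ω (y.1 0) (y.1 2) (y.1 5)) (H y)) l

variable {ω} {ψ : F → M →+ N} {l : Generic F V 6}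

lemma weighted_congr {H K : Generic F V 6 → M} (h : ∀ y, H y = K y) :
    weighted ω ψ H l = weighted ω ψ K l := by
  rw [funext h]

lemma weighted_add (H K : Generic F V 6 → M) :
    weighted ω ψ (fun y => H y + K y) l = weighted ω ψ H l + weighted ω ψ K l := by
  simp only [weighted, map_add, alternation_add]

lemma weighted_sub (H K : Generic F V 6 → M) :
    weighted ω ψ (fun y => H y - K y) l = weighted ω ψ H l - weighted ω ψ K l := by
  simp only [weighted, map_sub, alternation_sub]

lemma weighted_neg (H : Generic F V 6 → M) :
    weighted ω ψ (fun y => -H y) l = -weighted ω ψ H l := by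
  simp only [weighted, map_neg, alternation_neg]

lemma weighted_zero : weighted ω ψ (fun _ => 0) l = 0 := by
  simp only [weighted, map_zero, alternation_zero]

lemma sum_ratioVal {f : F → M} (hf : FiveTermFunction f) (y : Generic F V 6) (i a b c d e : Fin 6)
    (h : [i, a, b, c, d, e].Nodup) :
    ratioVal ω f i b c d e y - ratioVal ω f i a c d e y + ratioVal ω f i a b d e y
      - ratioVal ω f i a b c e y + ratioVal ω f i a b c d y = 0 := by
  refine hf.sum_projVal ω (y.1 i) (fun k => y.1 (![a, b, c, d, e] k)) fun j k hjk _ => ?_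
  have h1 : Function.Injective ![i, a, b, c, d, e] := by
    rw [← List.nodup_ofFn]
    simpa [List.ofFn_succ] using h
  have h2 : ∀ j : Fin 5, ![a, b, c, d, e] j = ![i, a, b, c, d, e] j.succ := fun _ => rfl
  rw [h2, h2]
  refine vol_ne_zero ω y (i := ![i, a, b, c, d, e] 0) (h1.ne (Fin.succ_ne_zero _).symm)
    (h1.ne (Fin.succ_ne_zero _).symm) (h1.ne ?_)
  simpa using hjk.ne

lemma sum_ratioVal_dual {f : F → M} (hf : FiveTermFunction f) (y : Generic F V 6) (a b c d e : Fin 6)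
    (h : [a, b, c, d, e].Nodup) :
    ratioVal ω f a b c d e y - ratioVal ω f b a c d e y + ratioVal ω f c a b d e y
      - ratioVal ω f d a b c e y + ratioVal ω f e a b c d y = 0 := by
  have h1 : Function.Injective ![a, b, c, d, e] := by
    rw [← List.nodup_ofFn]
    simpa [List.ofFn_succ] using h
  exact hf.sum_dual ω (reindex y ![a, b, c, d, e] h1)

section Neg

variable [NeZero (2 : F)] [Module F N]

/-- Twice `ψ (-1)` is `ψ 1 = 0`, and `2` can be cancelled in an `F`-module. So `ψ` does not see the
order of the vectors in a determinant. -/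
lemma LogPairing.map_neg (hψ : LogPairing ψ) {x : F} (hx : x ≠ 0) : ψ (-x) = ψ x := by
  have h1 : ψ 1 = 0 := by
    have h := hψ.map_mul (one_ne_zero (α := F)) (one_ne_zero (α := F))
    rw [mul_one] at h
    exact left_eq_add.mp h
  have h2 : ψ (-1) = 0 := by
    have h := hψ.map_mul (neg_ne_zero.mpr (one_ne_zero (α := F)))
      (neg_ne_zero.mpr (one_ne_zero (α := F)))
    rw [neg_mul_neg, mul_one, h1] at h
    ext m
    refine FiveTermFunction.eq_zero_of_nsmul (F := F) 2 (by exact_mod_cast NeZero.ne (2 : F)) ?_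
    rw [two_nsmul]
    exact (DFunLike.congr_fun h m).symm
  rw [← neg_one_mul, hψ.map_mul (neg_ne_zero.mpr one_ne_zero) hx, h2, zero_add]

lemma LogPairing.map_vol_swap₁ (hψ : LogPairing ψ) {x y z : V} (h : vol ω x y z ≠ 0) :
    ψ (vol ω y x z) = ψ (vol ω x y z) := by
  rw [vol_swap₁, hψ.map_neg h]

lemma LogPairing.map_vol_swap₂ (hψ : LogPairing ψ) {x y z : V} (h : vol ω x y z ≠ 0) :
    ψ (vol ω x z y) = ψ (vol ω x y z) := by
  rw [vol_swap₂, hψ.map_neg h]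

lemma LogPairing.map_vol_perm (hψ : LogPairing ψ) (y : Generic F V 6) {a b c : Fin 6}
    (h : [a, b, c].Perm [0, 2, 5]) :
    ψ (vol ω (y.1 a) (y.1 b) (y.1 c)) = ψ (vol ω (y.1 0) (y.1 2) (y.1 5)) := by
  have n025 : vol ω (y.1 0) (y.1 2) (y.1 5) ≠ 0 :=
    vol_ne_zero ω y (by decide) (by decide) (by decide)
  have n052 : vol ω (y.1 0) (y.1 5) (y.1 2) ≠ 0 :=
    vol_ne_zero ω y (by decide) (by decide) (by decide)
  have n205 : vol ω (y.1 2) (y.1 0) (y.1 5) ≠ 0 :=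
    vol_ne_zero ω y (by decide) (by decide) (by decide)
  have n502 : vol ω (y.1 5) (y.1 0) (y.1 2) ≠ 0 :=
    vol_ne_zero ω y (by decide) (by decide) (by decide)
  have e : (a = 0 ∧ b = 2 ∧ c = 5) ∨ (a = 0 ∧ b = 5 ∧ c = 2) ∨ (a = 2 ∧ b = 0 ∧ c = 5) ∨
      (a = 2 ∧ b = 5 ∧ c = 0) ∨ (a = 5 ∧ b = 0 ∧ c = 2) ∨ (a = 5 ∧ b = 2 ∧ c = 0) := by
    revert a b c; decide
  rcases e with ⟨rfl, rfl, rfl⟩ | ⟨rfl, rfl, rfl⟩ | ⟨rfl, rfl, rfl⟩ | ⟨rfl, rfl, rfl⟩ |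
    ⟨rfl, rfl, rfl⟩ | ⟨rfl, rfl, rfl⟩
  · rfl
  · exact hψ.map_vol_swap₂ n025
  · exact hψ.map_vol_swap₁ n025
  · rw [hψ.map_vol_swap₂ n205, hψ.map_vol_swap₁ n025]
  · rw [hψ.map_vol_swap₁ n052, hψ.map_vol_swap₂ n025]
  · rw [hψ.map_vol_swap₂ n502, hψ.map_vol_swap₁ n052, hψ.map_vol_swap₂ n025]

/-- A permutation preserving `{0, 2, 5}` changes the weight `Δ(y_0, y_2, y_5)` at most by a sign,
which `ψ` ignores. -/
lemma weighted_permute (hψ : LogPairing ψ) (π : Equiv.Perm (Fin 6))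
    (h : [π 0, π 2, π 5].Perm [0, 2, 5]) (H : Generic F V 6 → M) :
    weighted ω ψ (fun y => H (permute y π)) l =
      (Equiv.Perm.sign π : ℤ) • weighted ω ψ H l := by
  rw [weighted, weighted, ← alternation_permute]
  congr 1
  funext y
  rw [← hψ.map_vol_perm y h]
  rfl

end Neg

variable [NeZero (2 : F)] [NeZero (3 : F)] [Module F M] [Module F N] {f : F → M}

/-- The alternating sum of the pairings of the values at a projected cross-ratio. -/
def weightedRatio (ω : VolumeForm F V) (ψ : F → M →+ N) (f : F → M) (l : Generic F V 6)
    (i a b c d : Fin 6) : N :=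
  weighted ω ψ (ratioVal ω f i a b c d) l

lemma weightedRatio_swap₀₁ (hf : FiveTermFunction f) {i a b c d : Fin 6}
    (h : [i, a, b, c, d].Nodup) :
    weightedRatio ω ψ f l i b a c d = -weightedRatio ω ψ f l i a b c d := by
  rw [weightedRatio, weightedRatio, ← weighted_neg]
  exact weighted_congr (hf.ratioVal_swap₀₁ ω h)

lemma weightedRatio_swap₁₂ (hf : FiveTermFunction f) {i a b c d : Fin 6}
    (h : [i, a, b, c, d].Nodup) :
    weightedRatio ω ψ f l i a c b d = -weightedRatio ω ψ f l i a b c d := by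
  rw [weightedRatio, weightedRatio, ← weighted_neg]
  exact weighted_congr (hf.ratioVal_swap₁₂ ω h)

lemma weightedRatio_swap₂₃ (hf : FiveTermFunction f) {i a b c d : Fin 6}
    (h : [i, a, b, c, d].Nodup) :
    weightedRatio ω ψ f l i a b d c = -weightedRatio ω ψ f l i a b c d := by
  rw [weightedRatio, weightedRatio, ← weighted_neg]
  exact weighted_congr (hf.ratioVal_swap₂₃ ω h)

lemma weightedRatio_perm (hψ : LogPairing ψ) (π : Equiv.Perm (Fin 6))
    (h : [π 0, π 2, π 5].Perm [0, 2, 5] ∧ Equiv.Perm.sign π = -1) (i a b c d : Fin 6)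
    {i' a' b' c' d' : Fin 6} (e : i' = π i ∧ a' = π a ∧ b' = π b ∧ c' = π c ∧ d' = π d) :
    weightedRatio ω ψ f l i' a' b' c' d' = -weightedRatio ω ψ f l i a b c d := by
  obtain ⟨rfl, rfl, rfl, rfl, rfl⟩ := e
  have := weighted_permute (ω := ω) (l := l) hψ π h.1 (ratioVal ω f i a b c d)
  rw [h.2, Units.val_neg, Units.val_one, neg_one_zsmul] at this
  exact this

/-- In the relation for `y_1, y_4, y_2, y_3, y_5` projected from `y_0`, permutations within `{0, 2,
5}` and `{1, 3, 4}` identify the five terms up to sign with two of them, and the relation reads `2Y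
- 3Z = 0`. -/
lemma weightedRatio_projection_relation (hf : FiveTermFunction f) (hψ : LogPairing ψ) :
    (2 : ℤ) • weightedRatio ω ψ f l 0 1 4 2 3 = (3 : ℤ) • weightedRatio ω ψ f l 0 1 4 2 5 := by
  have h : weightedRatio ω ψ f l 0 4 2 3 5 - weightedRatio ω ψ f l 0 1 2 3 5
      + weightedRatio ω ψ f l 0 1 4 3 5 - weightedRatio ω ψ f l 0 1 4 2 5
      + weightedRatio ω ψ f l 0 1 4 2 3 = 0 := by
    simp only [weightedRatio, ← weighted_sub, ← weighted_add]
    rw [← weighted_zero (ω := ω) (ψ := ψ) (l := l)]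
    exact weighted_congr fun y => sum_ratioVal hf y 0 1 4 2 3 5 (by decide)
  have h1 : weightedRatio ω ψ f l 0 4 2 3 5 = -weightedRatio ω ψ f l 0 1 4 2 5 := by
    rw [weightedRatio_perm hψ (Equiv.swap 1 3) (by decide) 0 4 2 1 5 (by decide),
      weightedRatio_swap₁₂ hf (a := 4) (b := 1) (by decide),
      weightedRatio_swap₀₁ hf (a := 1) (b := 4) (by decide), neg_neg]
  have h2 : weightedRatio ω ψ f l 0 1 2 3 5 = weightedRatio ω ψ f l 0 1 4 2 5 := by
    rw [weightedRatio_perm hψ (Equiv.swap 3 4) (by decide) 0 1 2 4 5 (by decide),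
      weightedRatio_swap₁₂ hf (b := 4) (c := 2) (by decide), neg_neg]
  have h3 : weightedRatio ω ψ f l 0 1 4 3 5 = weightedRatio ω ψ f l 0 1 4 2 3 := by
    rw [weightedRatio_perm hψ (Equiv.swap 2 5) (by decide) 0 1 4 3 2 (by decide),
      weightedRatio_swap₂₃ hf (c := 2) (d := 3) (by decide), neg_neg]
  rw [h1, h2, h3] at h
  rw [← sub_eq_zero, ← h]
  abel

/-- The dual relation for `y_0, y_1, y_4, y_2, y_5`, one term per centre: the three centres in `{0,
2, 5}` give equal terms, and so do the two centres `1` and `4`. -/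
lemma weightedRatio_dual_relation (hf : FiveTermFunction f) (hψ : LogPairing ψ) :
    (3 : ℤ) • weightedRatio ω ψ f l 0 1 4 2 5 + (2 : ℤ) • weightedRatio ω ψ f l 1 4 0 2 5 = 0 := by
  have h : weightedRatio ω ψ f l 0 1 4 2 5 - weightedRatio ω ψ f l 1 0 4 2 5
      + weightedRatio ω ψ f l 4 0 1 2 5 - weightedRatio ω ψ f l 2 0 1 4 5
      + weightedRatio ω ψ f l 5 0 1 4 2 = 0 := by
    simp only [weightedRatio, ← weighted_sub, ← weighted_add]
    rw [← weighted_zero (ω := ω) (ψ := ψ) (l := l)]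
    exact weighted_congr fun y => sum_ratioVal_dual hf y 0 1 4 2 5 (by decide)
  have h1 : weightedRatio ω ψ f l 1 0 4 2 5 = -weightedRatio ω ψ f l 1 4 0 2 5 :=
    weightedRatio_swap₀₁ hf (by decide)
  have h2 : weightedRatio ω ψ f l 4 0 1 2 5 = weightedRatio ω ψ f l 1 4 0 2 5 := by
    rw [weightedRatio_perm hψ (Equiv.swap 1 4) (by decide) 1 0 4 2 5 (by decide), h1, neg_neg]
  have h3 : weightedRatio ω ψ f l 2 0 1 4 5 = -weightedRatio ω ψ f l 0 1 4 2 5 := by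
    rw [weightedRatio_perm hψ (Equiv.swap 0 2) (by decide) 0 2 1 4 5 (by decide),
      weightedRatio_swap₀₁ hf (a := 1) (b := 2) (by decide),
      weightedRatio_swap₁₂ hf (b := 4) (c := 2) (by decide), neg_neg]
  have h4 : weightedRatio ω ψ f l 5 0 1 4 2 = weightedRatio ω ψ f l 0 1 4 2 5 := by
    rw [weightedRatio_perm hψ (Equiv.swap 0 5) (by decide) 0 5 1 4 2 (by decide),
      weightedRatio_swap₀₁ hf (a := 1) (b := 5) (by decide),
      weightedRatio_swap₁₂ hf (b := 4) (c := 5) (by decide),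
      weightedRatio_swap₂₃ hf (c := 2) (d := 5) (by decide), neg_neg, neg_neg]
  rw [h1, h2, h3, h4] at h
  rw [← h]
  abel

lemma weighted_tripleRatio (hf : FiveTermFunction f) (hψ : LogPairing ψ) :
    (6 : ℤ) • weighted ω ψ (fun y => f (tripleRatio ω y.1)) l =
      (5 : ℤ) • weightedRatio ω ψ f l 1 4 0 2 5 := by
  have h14 : weighted ω ψ (fun y => f (tripleRatio ω (permute y (Equiv.swap 1 4)).1)) l =
      -weighted ω ψ (fun y => f (tripleRatio ω y.1)) l := by
    have h := weighted_permute (ω := ω) (l := l) hψ (Equiv.swap 1 4) (by decide)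
      (fun y => f (tripleRatio ω y.1))
    rwa [Equiv.Perm.sign_swap (by decide), Units.val_neg, Units.val_one, neg_one_zsmul] at h
  obtain ⟨s, hs⟩ : ∃ s : Generic F V 6 → M, s = fun y =>
      f ((vol ω (y.1 0) (y.1 1) (y.1 3) * vol ω (y.1 2) (y.1 5) (y.1 4)) /
          (vol ω (y.1 2) (y.1 5) (y.1 1) * vol ω (y.1 0) (y.1 4) (y.1 3))) := ⟨_, rfl⟩
  -- Exchanging `2` and `5` negates numerator and denominator of the argument of `s`, so `s` is
  -- invariant under an odd permutation that keeps the weight.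
  have h25 : weighted ω ψ s l = 0 := by
    have h := weighted_permute (ω := ω) (l := l) hψ (Equiv.swap 2 5) (by decide) s
    have e : (fun y => s (permute y (Equiv.swap 2 5))) = s := by
      rw [hs]
      funext y
      have p : (permute y (Equiv.swap 2 5)).1 = ![y.1 0, y.1 1, y.1 5, y.1 3, y.1 4, y.1 2] := by
        ext k
        fin_cases k <;> rfl
      simp only [p, Matrix.cons_val]
      rw [vol_swap₁ ω (y.1 2) (y.1 5), vol_swap₁ ω (y.1 2) (y.1 5), mul_neg, neg_mul,
        neg_div_neg_eq]
    rw [e, Equiv.Perm.sign_swap (by decide), Units.val_neg, Units.val_one, neg_one_zsmul] at h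
    refine FiveTermFunction.eq_zero_of_nsmul (F := F) 2 (by exact_mod_cast NeZero.ne (2 : F)) ?_
    rw [two_nsmul]
    nth_rewrite 1 [h]
    exact neg_add_cancel _
  have h02 : weightedRatio ω ψ f l 2 1 4 0 5 = -weightedRatio ω ψ f l 0 1 4 2 5 :=
    weightedRatio_perm hψ (Equiv.swap 0 2) (by decide) 0 1 4 2 5 (by decide)
  have h := weighted_congr (ω := ω) (ψ := ψ) (l := l) (hf.tripleRatio_relation ω)
  have h' := weighted_congr (ω := ω) (ψ := ψ) (l := l) fun y =>
    (congrFun hs y : s y = _)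
  rw [weighted_add, weighted_sub, weighted_add, h14, ← h', h25, add_zero] at h
  change _ = _ - weightedRatio ω ψ f l 0 1 4 2 3 + weightedRatio ω ψ f l 2 1 4 0 5 at h
  rw [h02] at h
  have hYZ := weightedRatio_projection_relation (ω := ω) (l := l) hf hψ
  have hZW := weightedRatio_dual_relation (ω := ω) (l := l) hf hψ
  have hYW : weightedRatio ω ψ f l 0 1 4 2 3 + weightedRatio ω ψ f l 1 4 0 2 5 = 0 := by
    refine FiveTermFunction.eq_zero_of_nsmul (F := F) 2 (by exact_mod_cast NeZero.ne (2 : F)) ?_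
    rw [← hZW, ← hYZ]
    abel
  -- With `2T = -Y - Z`, `2Y = 3Z` and `Y = -W`: `6T = -3Y - 3Z = -5Y = 5W`.
  linear_combination (norm := module) (3 : ℤ) • h + hYZ - (5 : ℤ) • hYW

end Alternation

/-! ### From the triple-ratio to the faces -/

section Square

variable {F : Type*} [Field F] {V : Type*} [AddCommGroup V] [Module F V]
  [Fact (Module.finrank F V = 3)] {ω : VolumeForm F V}
  {M N : Type*} [AddCommGroup M] [AddCommGroup N] {f : F → M} {ψ : F → M →+ N}

lemma LogPairing.map_div (hψ : LogPairing ψ) {x y : F} (hx : x ≠ 0) (hy : y ≠ 0) :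
    ψ (x / y) = ψ x - ψ y := by
  rw [eq_sub_iff_add_eq, ← hψ.map_mul (div_ne_zero hx hy) hy, div_mul_cancel₀ _ hy]

lemma permute_val_eq (y : Generic F V 6) (π : Equiv.Perm (Fin 6)) (e : Fin 6 → Fin 6)
    (h : ∀ k, π k = e k) : (permute y π).1 = fun k => y.1 (e k) :=
  funext fun k => congrArg y.1 (h k)

lemma tripleRatio_ne_zero (y : Generic F V 6) : tripleRatio ω y.1 ≠ 0 := by
  have n (i j k) (h : i ≠ j ∧ i ≠ k ∧ j ≠ k) : vol ω (y.1 i) (y.1 j) (y.1 k) ≠ 0 :=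
    vol_ne_zero ω y h.1 h.2.1 h.2.2
  exact div_ne_zero
    (mul_ne_zero (mul_ne_zero (n _ _ _ (by decide)) (n _ _ _ (by decide))) (n _ _ _ (by decide)))
    (mul_ne_zero (mul_ne_zero (n _ _ _ (by decide)) (n _ _ _ (by decide))) (n _ _ _ (by decide)))

variable (l : Generic F V 6) [NeZero (2 : F)] [NeZero (3 : F)] [Module F M] [Module F N]

/-- `ψ` splits the triple-ratio into six determinants, permuted transitively by even permutations
that fix or invert it. Those that carry `Δ(y_0, y_2, y_5)` to a denominator factor invert the
triple-ratio; as `f` is odd under inversion, this sign cancels the one of the denominator, and all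
six terms agree. -/
lemma alternation_tripleRatio (hf : FiveTermFunction f) (hψ : LogPairing ψ) :
    alternation (fun y : Generic F V 6 => ψ (tripleRatio ω y.1) (f (tripleRatio ω y.1))) l =
      (6 : ℤ) • weighted ω ψ (fun y => f (tripleRatio ω y.1)) l := by
  have n (y : Generic F V 6) (i j k : Fin 6) (h : i ≠ j ∧ i ≠ k ∧ j ≠ k) :
      vol ω (y.1 i) (y.1 j) (y.1 k) ≠ 0 := vol_ne_zero ω y h.1 h.2.1 h.2.2
  have pos : ∀ π : Equiv.Perm (Fin 6), Equiv.Perm.sign π = 1 →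
      (∀ y : Generic F V 6, tripleRatio ω (permute y π).1 = tripleRatio ω y.1) →
      ∀ a b c : Fin 6, π 0 = a ∧ π 2 = b ∧ π 5 = c →
      alternation (fun y : Generic F V 6 => ψ (vol ω (y.1 a) (y.1 b) (y.1 c))
        (f (tripleRatio ω y.1))) l = weighted ω ψ (fun y => f (tripleRatio ω y.1)) l := by
    rintro π hs ht _ _ _ ⟨rfl, rfl, rfl⟩
    have h := alternation_permute (fun y : Generic F V 6 =>
      ψ (vol ω (y.1 0) (y.1 2) (y.1 5)) (f (tripleRatio ω y.1))) l π
    rw [hs, Units.val_one, one_zsmul] at h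
    simp only [ht] at h
    exact h
  have neg : ∀ π : Equiv.Perm (Fin 6), Equiv.Perm.sign π = 1 →
      (∀ y : Generic F V 6, tripleRatio ω (permute y π).1 = (tripleRatio ω y.1)⁻¹) →
      ∀ a b c : Fin 6, π 0 = a ∧ π 2 = b ∧ π 5 = c →
      alternation (fun y : Generic F V 6 => ψ (vol ω (y.1 a) (y.1 b) (y.1 c))
        (f (tripleRatio ω y.1))) l = -weighted ω ψ (fun y => f (tripleRatio ω y.1)) l := by
    rintro π hs ht _ _ _ ⟨rfl, rfl, rfl⟩
    have h := alternation_permute (fun y : Generic F V 6 =>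
      ψ (vol ω (y.1 0) (y.1 2) (y.1 5)) (f (tripleRatio ω y.1))) l π
    rw [hs, Units.val_one, one_zsmul] at h
    simp only [ht, hf.map_inv (tripleRatio_ne_zero _), map_neg, alternation_neg] at h
    exact neg_eq_iff_eq_neg.mp h
  have h205 := pos 1 (by decide) (fun _ => rfl) 0 2 5 (by decide)
  have h013 := pos (Equiv.swap 0 1 * Equiv.swap 1 2 * (Equiv.swap 3 4 * Equiv.swap 4 5))
    (by decide) (fun y => by
      rw [permute_val_eq y _ ![1, 2, 0, 4, 5, 3] (by decide)]
      simp only [tripleRatio, Matrix.cons_val]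
      congr 1 <;> ring) 1 0 3 (by decide)
  have h124 := pos (Equiv.swap 0 2 * Equiv.swap 1 2 * (Equiv.swap 3 5 * Equiv.swap 4 5))
    (by decide) (fun y => by
      rw [permute_val_eq y _ ![2, 0, 1, 5, 3, 4] (by decide)]
      simp only [tripleRatio, Matrix.cons_val]
      congr 1 <;> ring) 2 1 4 (by decide)
  have h125 := neg (Equiv.swap 0 1 * Equiv.swap 3 4) (by decide) (fun y => by
      rw [permute_val_eq y _ ![1, 0, 2, 4, 3, 5] (by decide)]
      simp only [tripleRatio, Matrix.cons_val, inv_div, vol_swap₁ ω (y.1 0) (y.1 1),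
        vol_swap₁ ω (y.1 0) (y.1 2), vol_swap₁ ω (y.1 1) (y.1 2), mul_neg, neg_mul, neg_neg,
        neg_div, div_neg]
      congr 1 <;> ring) 1 2 5 (by decide)
  have h203 := neg (Equiv.swap 0 2 * Equiv.swap 3 5) (by decide) (fun y => by
      rw [permute_val_eq y _ ![2, 1, 0, 5, 4, 3] (by decide)]
      simp only [tripleRatio, Matrix.cons_val, inv_div, vol_swap₁ ω (y.1 0) (y.1 1),
        vol_swap₁ ω (y.1 0) (y.1 2), vol_swap₁ ω (y.1 1) (y.1 2), mul_neg, neg_mul, neg_neg,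
        neg_div, div_neg]
      congr 1 <;> ring) 2 0 3 (by decide)
  have h014 := neg (Equiv.swap 1 2 * Equiv.swap 4 5) (by decide) (fun y => by
      rw [permute_val_eq y _ ![0, 2, 1, 3, 5, 4] (by decide)]
      simp only [tripleRatio, Matrix.cons_val, inv_div, vol_swap₁ ω (y.1 0) (y.1 1),
        vol_swap₁ ω (y.1 0) (y.1 2), vol_swap₁ ω (y.1 1) (y.1 2), mul_neg, neg_mul, neg_neg,
        neg_div, div_neg]
      congr 1 <;> ring) 0 1 4 (by decide)
  -- Numerator determinants are written in the order in which the permutations above send `(0, 2,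
  -- 5)`.
  have e : ∀ y : Generic F V 6, ψ (tripleRatio ω y.1) (f (tripleRatio ω y.1)) =
      ψ (vol ω (y.1 1) (y.1 0) (y.1 3)) (f (tripleRatio ω y.1))
      + ψ (vol ω (y.1 2) (y.1 1) (y.1 4)) (f (tripleRatio ω y.1))
      + ψ (vol ω (y.1 0) (y.1 2) (y.1 5)) (f (tripleRatio ω y.1))
      - (ψ (vol ω (y.1 0) (y.1 1) (y.1 4)) (f (tripleRatio ω y.1))
      + ψ (vol ω (y.1 1) (y.1 2) (y.1 5)) (f (tripleRatio ω y.1))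
      + ψ (vol ω (y.1 2) (y.1 0) (y.1 3)) (f (tripleRatio ω y.1))) := by
    intro y
    have n013 := n y 0 1 3 (by decide)
    have n124 := n y 1 2 4 (by decide)
    have n205 := n y 2 0 5 (by decide)
    have n014 := n y 0 1 4 (by decide)
    have n125 := n y 1 2 5 (by decide)
    have n203 := n y 2 0 3 (by decide)
    have h : ψ (tripleRatio ω y.1) = _ :=
      hψ.map_div (mul_ne_zero (mul_ne_zero n013 n124) n205)
        (mul_ne_zero (mul_ne_zero n014 n125) n203)
    rw [hψ.map_mul (mul_ne_zero n013 n124) n205, hψ.map_mul n013 n124,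
      hψ.map_mul (mul_ne_zero n014 n125) n203, hψ.map_mul n014 n125] at h
    rw [h, hψ.map_vol_swap₁ n013, hψ.map_vol_swap₁ n124, hψ.map_vol_swap₁ n205]
    simp only [AddMonoidHom.sub_apply, AddMonoidHom.add_apply]
  rw [funext e]
  simp only [alternation_add, alternation_sub, h013, h124, h205, h014, h125, h203]
  abel

/-- The pairing of `Δ(y_3, y_4, y_5)` with the projected cross-ratio `r(y_1 | y_2, y_3, y_4, y_5)`. -/
def pairedRatio (ω : VolumeForm F V) (ψ : F → M →+ N) (f : F → M) (y : Fin 6 → V) : N :=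
  ψ (vol ω (y 3) (y 4) (y 5)) (projVal ω f (y 1) (y 2) (y 3) (y 4) (y 5))

/-- The even relabelling `(0 3)(2 4)` puts the unused vector first and the centre second, ready for
expansion position by position. -/
lemma alternation_pairedRatio :
    alternation (fun y : Generic F V 6 => pairedRatio ω ψ f y.1) l =
      weightedRatio ω ψ f l 1 4 0 2 5 := by
  have h := alternation_permute (fun y : Generic F V 6 =>
      ψ (vol ω (y.1 0) (y.1 2) (y.1 5)) (ratioVal ω f 1 4 0 2 5 y)) l
      (Equiv.swap 0 3 * Equiv.swap 2 4)
  have hs : Equiv.Perm.sign (Equiv.swap (0 : Fin 6) 3 * Equiv.swap 2 4) = 1 := by decide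
  rw [hs, Units.val_one, one_zsmul] at h
  refine Eq.trans ?_ h
  congr 1

/-- Permuting `a, b, c` changes the cross-ratio value by the sign and leaves `ψ` of the determinant
unchanged, so the six signed terms agree. -/
lemma sum_perm_pairedRatio (hf : FiveTermFunction f) (hψ : LogPairing ψ) (u : Generic F V 6)
    {k a b c : Fin 6} (h : [1, k, a, b, c].Nodup) :
    ∑ τ : Equiv.Perm (Fin 3), (Equiv.Perm.sign τ : ℤ) •
      ψ (vol ω (u.1 (![a, b, c] (τ 0))) (u.1 (![a, b, c] (τ 1))) (u.1 (![a, b, c] (τ 2))))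
        (ratioVal ω f 1 k (![a, b, c] (τ 0)) (![a, b, c] (τ 1)) (![a, b, c] (τ 2)) u) =
      (6 : ℤ) • ψ (vol ω (u.1 a) (u.1 b) (u.1 c)) (ratioVal ω f 1 k a b c u) := by
  obtain ⟨h1k, h1a, h1b, h1c, hka, hkb, hkc, hab, hac, hbc⟩ := nodup_five h
  have n : ∀ p q r : Fin 6, p ≠ q → p ≠ r → q ≠ r → vol ω (u.1 p) (u.1 q) (u.1 r) ≠ 0 :=
    fun p q r h1 h2 h3 => vol_ne_zero ω u h1 h2 h3
  have s1 : ∀ p q r : Fin 6, [1, k, p, q, r].Nodup →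
      ψ (vol ω (u.1 p) (u.1 r) (u.1 q)) (ratioVal ω f 1 k p r q u) =
        -ψ (vol ω (u.1 p) (u.1 q) (u.1 r)) (ratioVal ω f 1 k p q r u) := fun p q r h => by
    obtain ⟨-, -, -, -, -, -, -, hpq, hpr, hqr⟩ := nodup_five h
    rw [hf.ratioVal_swap₂₃ ω h, hψ.map_vol_swap₂ (n p q r hpq hpr hqr), map_neg]
  have s2 : ∀ p q r : Fin 6, [1, k, p, q, r].Nodup →
      ψ (vol ω (u.1 q) (u.1 p) (u.1 r)) (ratioVal ω f 1 k q p r u) =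
        -ψ (vol ω (u.1 p) (u.1 q) (u.1 r)) (ratioVal ω f 1 k p q r u) := fun p q r h => by
    obtain ⟨-, -, -, -, -, -, -, hpq, hpr, hqr⟩ := nodup_five h
    rw [hf.ratioVal_swap₁₂ ω h, hψ.map_vol_swap₁ (n p q r hpq hpr hqr), map_neg]
  have hacb : [1, k, a, c, b].Nodup := by
    simp [h1k, h1a, h1b, h1c, hka, hkb, hkc, hab, hac, hbc.symm]
  have hbac : [1, k, b, a, c].Nodup := by
    simp [h1k, h1a, h1b, h1c, hka, hkb, hkc, hab.symm, hac, hbc]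
  have e1 := s1 a b c h
  have e2 := s2 a b c h
  have e3 := s2 a c b hacb
  have e4 := s1 b a c hbac
  have hbca : [1, k, b, c, a].Nodup := by
    simp [h1k, h1a, h1b, h1c, hka, hkb, hkc, hab.symm, hac.symm, hbc]
  have e5 := s2 b c a hbca
  refine (sum_perm_three (fun p q r : Fin 6 => ψ (vol ω (u.1 p) (u.1 q) (u.1 r))
    (ratioVal ω f 1 k p q r u)) ![a, b, c]).trans ?_
  simp only [Matrix.cons_val]
  rw [e5, e4, e3, e2, e1]
  abel

/-- Moving the `k`-th point to the front costs `(-1)^k`, which cancels the sign of the expansion.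
The four determinants are then paired with one cross-ratio value, and additivity of `ψ` collects
them into their product. -/
lemma sum_pairedRatio (hf : FiveTermFunction f) (hψ : LogPairing ψ) (u : Generic F V 6) :
    ∑ k : Fin 4, (-1 : ℤ) ^ (k : ℕ) • ∑ τ : Equiv.Perm (Fin 3), (Equiv.Perm.sign τ : ℤ) •
      pairedRatio ω ψ f (Fin.cons (u.1 0) (Fin.cons (u.1 1) (Fin.cons (u.1 (![2, 3, 4, 5] k))
        fun a => u.1 (![2, 3, 4, 5] (k.succAbove (τ a)))))) =
      (6 : ℤ) • ψ (∏ k : Fin 4, omitVol ω (fun a => u.1 (![2, 3, 4, 5] a)) k)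
        (ratioVal ω f 1 2 3 4 5 u) := by
  have e : ∀ (k : Fin 4) (τ : Equiv.Perm (Fin 3)),
      pairedRatio ω ψ f (Fin.cons (u.1 0) (Fin.cons (u.1 1) (Fin.cons (u.1 (![2, 3, 4, 5] k))
        fun a => u.1 (![2, 3, 4, 5] (k.succAbove (τ a)))))) =
      ψ (vol ω (u.1 (![2, 3, 4, 5] (k.succAbove (τ 0)))) (u.1 (![2, 3, 4, 5] (k.succAbove (τ 1))))
        (u.1 (![2, 3, 4, 5] (k.succAbove (τ 2)))))
        (ratioVal ω f 1 (![2, 3, 4, 5] k) (![2, 3, 4, 5] (k.succAbove (τ 0)))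
          (![2, 3, 4, 5] (k.succAbove (τ 1))) (![2, 3, 4, 5] (k.succAbove (τ 2))) u) :=
    fun _ _ => rfl
  have r : ∀ (k : Fin 4) (a : Fin 3), (![2, 3, 4, 5] : Fin 4 → Fin 6) (k.succAbove a) =
      (![(![3, 4, 5] : Fin 3 → Fin 6), ![2, 4, 5], ![2, 3, 5], ![2, 3, 4]] : Fin 4 → Fin 3 → Fin 6)
        k a := by decide
  simp only [e]
  simp only [r, Fin.sum_univ_four, Matrix.cons_val]
  rw [sum_perm_pairedRatio hf hψ u (by decide), sum_perm_pairedRatio hf hψ u (by decide),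
    sum_perm_pairedRatio hf hψ u (by decide), sum_perm_pairedRatio hf hψ u (by decide)]
  have h1 : ratioVal ω f 1 3 2 4 5 u = -ratioVal ω f 1 2 3 4 5 u :=
    hf.ratioVal_swap₀₁ ω (by decide) u
  have h2 : ratioVal ω f 1 4 2 3 5 u = ratioVal ω f 1 2 3 4 5 u := by
    rw [hf.ratioVal_swap₀₁ ω (a := 2) (b := 4) (by decide),
      hf.ratioVal_swap₁₂ ω (b := 3) (c := 4) (by decide), neg_neg]
  have h3 : ratioVal ω f 1 5 2 3 4 u = -ratioVal ω f 1 2 3 4 5 u := by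
    rw [hf.ratioVal_swap₀₁ ω (a := 2) (b := 5) (by decide),
      hf.ratioVal_swap₁₂ ω (b := 3) (c := 5) (by decide),
      hf.ratioVal_swap₂₃ ω (c := 4) (d := 5) (by decide), neg_neg]
  have n (i j k : Fin 6) (h : i ≠ j ∧ i ≠ k ∧ j ≠ k) :
      vol ω (u.1 i) (u.1 j) (u.1 k) ≠ 0 := vol_ne_zero ω u h.1 h.2.1 h.2.2
  have n345 := n 3 4 5 (by decide)
  have n245 := n 2 4 5 (by decide)
  have n235 := n 2 3 5 (by decide)
  have n234 := n 2 3 4 (by decide)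
  simp only [omitVol, r, Fin.prod_univ_four, Matrix.cons_val]
  rw [hψ.map_mul (mul_ne_zero (mul_ne_zero n345 n245) n235) n234,
    hψ.map_mul (mul_ne_zero n345 n245) n235, hψ.map_mul n345 n245, h1, h2, h3]
  simp only [AddMonoidHom.add_apply, map_neg]
  norm_num

/-- The indices `j` and `i`, the second one of the remaining five, followed by the other four. -/
def twoFaces (j : Fin 6) (i : Fin 5) : Fin 6 → Fin 6 :=
  ![j, j.succAbove i, j.succAbove (i.succAbove 0), j.succAbove (i.succAbove 1),
    j.succAbove (i.succAbove 2), j.succAbove (i.succAbove 3)]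

lemma twoFaces_injective : ∀ (j : Fin 6) (i : Fin 5), Function.Injective (twoFaces j i) := by
  decide

/-- `pairedRatio` ignores its vector `0`, so expanding at that position produces the faces;
expanding at position `1` produces the centre of projection, and `sum_pairedRatio` sums over the
rest. -/
lemma alternation_eq_sum_faces (hf : FiveTermFunction f) (hψ : LogPairing ψ) :
    alternation (fun y : Generic F V 6 => pairedRatio ω ψ f y.1) l =
      (6 : ℤ) • ∑ j : Fin 6, (-1 : ℤ) ^ (j : ℕ) • ∑ i : Fin 5, (-1 : ℤ) ^ (i : ℕ) •
        ψ (omitProd ω (face (m := 5) j l).1 i) (f (projRatio ω ((face (m := 5) j l).1 i)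
          fun k => (face (m := 5) j l).1 (i.succAbove k))) := by
  refine (sum_perm_succ (pairedRatio ω ψ f) l.1).trans ?_
  rw [Finset.smul_sum]
  refine Finset.sum_congr rfl fun j _ => ?_
  rw [smul_comm]
  congr 1
  refine (sum_perm_succ (fun y : Fin 5 → V => pairedRatio ω ψ f (Fin.cons (l.1 j) y))
    (fun k => l.1 (j.succAbove k))).trans ?_
  rw [Finset.smul_sum]
  refine Finset.sum_congr rfl fun i _ => ?_
  rw [smul_comm]
  congr 1
  refine (sum_perm_succ (fun y : Fin 4 → V => pairedRatio ω ψ f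
    (Fin.cons (l.1 j) (Fin.cons (l.1 (j.succAbove i)) y)))
    (fun k => l.1 (j.succAbove (i.succAbove k)))).trans ?_
  have hinj := twoFaces_injective j i
  have h := sum_pairedRatio (ω := ω) hf hψ (reindex l (twoFaces j i) hinj)
  have h0 : (reindex l (twoFaces j i) hinj).1 0 = l.1 j := rfl
  have h1 : (reindex l (twoFaces j i) hinj).1 1 = l.1 (j.succAbove i) := rfl
  have hq : ∀ k : Fin 4, (reindex l (twoFaces j i) hinj).1 ((![2, 3, 4, 5] : Fin 4 → Fin 6) k) =
      l.1 (j.succAbove (i.succAbove k)) := by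
    intro k
    fin_cases k <;> rfl
  have hr : ratioVal ω f 1 2 3 4 5 (reindex l (twoFaces j i) hinj) =
      f (projRatio ω (l.1 (j.succAbove i)) fun k => l.1 (j.succAbove (i.succAbove k))) := rfl
  simp only [h0, h1, hq, hr] at h
  exact h

theorem alternation_tripleRatio_eq_sum_faces (hf : FiveTermFunction f) (hψ : LogPairing ψ) :
    alternation (fun y : Generic F V 6 => ψ (tripleRatio ω y.1) (f (tripleRatio ω y.1))) l =
      (30 : ℤ) • ∑ j : Fin 6, (-1 : ℤ) ^ (j : ℕ) • ∑ i : Fin 5, (-1 : ℤ) ^ (i : ℕ) •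
        ψ (omitProd ω (face (m := 5) j l).1 i) (f (projRatio ω ((face (m := 5) j l).1 i)
          fun k => (face (m := 5) j l).1 (i.succAbove k))) := by
  rw [alternation_tripleRatio l hf hψ, weighted_tripleRatio hf hψ,
    ← alternation_pairedRatio, alternation_eq_sum_faces l hf hψ, smul_smul]
  norm_num

end Square


/-! ### The two components of the middle term -/

section Components

variable {F : Type*} [Field F] (D : Derivation ℤ F F)

lemma intSymb_one : intSymb (1 : F) = 0 := by simp [intSymb]

lemma symbB2_one : symbB2 (1 : F) = 0 := by
  rw [symbB2, intSymb_one]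
  rfl

lemma symb_one : symb D 1 = 0 := by simp [symb]

lemma symb2_one : symb2 D 1 = 0 := by
  apply Subtype.ext
  simp [symb2, symb_one]

lemma fiveTermFunction_symb2 [NeZero (2 : F)] : FiveTermFunction (symb2 D) :=
  ⟨symb2_one D, fun p hp => symb2_crossRatio D p hp⟩

/-- Values are taken in `F ⊗ B₂(F)` because the general identity cancels `2` and `3`, which `B₂(F)`
itself need not allow. -/
lemma fiveTermFunction_symbB2 : FiveTermFunction fun x : F => (1 : F) ⊗ₜ[ℤ] symbB2 x :=
  ⟨by rw [symbB2_one, TensorProduct.tmul_zero], fun p hp => by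
    simp only [← TensorProduct.tmul_smul, ← TensorProduct.tmul_sum]
    rw [symbB2_crossRatio p hp, TensorProduct.tmul_zero]⟩

/-- The pairing `m ↦ m ⊗ x`. -/
def tensorUnit (x : F) : Beta2 D →+ Beta2 D ⊗[ℤ] MulGroup F :=
  ((TensorProduct.mk ℤ (Beta2 D) (MulGroup F)).flip (unitOf x)).toAddMonoidHom

lemma logPairing_tensorUnit : LogPairing (tensorUnit D) :=
  ⟨fun hx hy => by
    ext m
    simp [tensorUnit, unitOf_mul hx hy]⟩

/-- The pairing `m ↦ (D(x) / x) m`. -/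
def dlogSmul (x : F) : F ⊗[ℤ] B2 F →+ F ⊗[ℤ] B2 F :=
  DistribSMul.toAddMonoidHom _ (dlog D x)

lemma logPairing_dlogSmul : LogPairing (dlogSmul D) :=
  ⟨fun hx hy => by
    ext m
    simp [dlogSmul, dlog_mul D hx hy, add_smul]⟩

lemma tensorUnit_symb2 (x y : F) : tensorUnit D x (symb2 D y) = symb2 D y ⊗ₜ[ℤ] unitOf x := rfl

lemma dlogSmul_symbB2 (x y : F) :
    dlogSmul D x ((1 : F) ⊗ₜ[ℤ] symbB2 y) = dlog D x ⊗ₜ[ℤ] symbB2 y := by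
  rw [dlogSmul, DistribSMul.toAddMonoidHom_apply, TensorProduct.smul_tmul', smul_eq_mul, mul_one]

/-- A triple-ratio of generic vectors is nonzero but may equal `1`; there every symbol is `0` by
convention and the formula persists. -/
lemma bdry3_symb3_of_ne_zero {x : F} (hx : x ≠ 0) :
    bdry3 D (symb3 D x) = (symb2 D x ⊗ₜ[ℤ] unitOf x, dlog D x ⊗ₜ[ℤ] symbB2 x) := by
  by_cases h1 : x = 1
  · rw [h1, symb3, symb_one, map_zero, map_zero, symb2_one, symbB2_one, TensorProduct.zero_tmul,
      TensorProduct.tmul_zero]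
    rfl
  · exact bdry3_symb3 D hx h1

end Components

/-! ### The left square -/

section Square

variable {F : Type*} [Field F] [NeZero (2 : F)] [NeZero (3 : F)] [NeZero (5 : F)]
  (D : Derivation ℤ F F) {V : Type*} [AddCommGroup V] [Module F V]
  [Fact (Module.finrank F V = 3)] (ω : VolumeForm F V)

/-- `30/90 = 1/3`; cancelling `30 = 2 * 3 * 5` is where `5` has to be invertible. -/
lemma smul_eq_smul_of_eq_thirty {N : Type*} [AddCommGroup N] [Module F N] {a b : N}
    (h : a = (30 : ℤ) • b) : (-(1 / 90) : F) • a = (-(1 / 3) : F) • b := by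
  rw [h, ← Int.cast_smul_eq_zsmul F, smul_smul]
  congr 1
  have h2 := NeZero.ne (2 : F)
  have h3 := NeZero.ne (3 : F)
  have h5 := NeZero.ne (5 : F)
  have h90 : (90 : F) = 2 * 3 * 3 * 5 := by norm_num
  have h30 : ((30 : ℤ) : F) = 2 * 3 * 5 := by norm_num
  rw [h90, h30]
  field_simp

lemma bdry3_tau2Val (l : Generic F V 6) :
    bdry3 D (tau2Val D ω l.1) =
      ∑ j : Fin 6, (-1 : ℤ) ^ (j : ℕ) • tau1Val D ω (face (m := 5) j l).1 := by
  have h1 := alternation_tripleRatio_eq_sum_faces (ω := ω) l (fiveTermFunction_symb2 D)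
    (logPairing_tensorUnit D)
  have h2 := alternation_tripleRatio_eq_sum_faces (ω := ω) l (fiveTermFunction_symbB2 (F := F))
    (logPairing_dlogSmul D)
  have hb : ∀ σ : Equiv.Perm (Fin 6), bdry3 D (symb3 D (tripleRatio ω fun k => l.1 (σ k))) = _ :=
    fun σ => bdry3_symb3_of_ne_zero D (tripleRatio_ne_zero (ω := ω) (permute l σ))
  simp only [tensorUnit_symb2] at h1
  simp only [dlogSmul_symbB2] at h2
  simp only [tau2Val, tau1Val, map_smul, map_sum, map_zsmul, hb]
  have hc : ∀ j : Fin 6, ∀ x : Mid D, (-1 : ℤ) ^ (j : ℕ) • (-(1 / 3) : F) • x =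
      (-(1 / 3) : F) • (-1 : ℤ) ^ (j : ℕ) • x := fun j x => smul_comm _ _ _
  simp_rw [hc]
  rw [← Finset.smul_sum]
  refine Prod.ext ?_ ?_
  · simp only [Prod.smul_fst, Prod.fst_sum]
    exact smul_eq_smul_of_eq_thirty h1
  · simp only [Prod.smul_snd, Prod.snd_sum]
    exact smul_eq_smul_of_eq_thirty h2

lemma bdry3_comp_tau2 :
    (bdry3 D).toAddMonoidHom.comp (tau2 D ω) = (tau1 D ω).comp (grassD F V 5) := by
  refine chain_hom_ext (m := 6) fun l => ?_
  have h2 : tau2 D ω (conf l) = tau2Val D ω l.1 := chainLift_conf _ _ l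
  have h1 : ∀ l : Generic F V 5, tau1 D ω (conf l) = tau1Val D ω l.1 := chainLift_conf _ _
  have h : tau1 D ω (grassD F V 5 (conf l)) =
      ∑ j : Fin 6, (-1 : ℤ) ^ (j : ℕ) • tau1Val D ω (face (m := 5) j l).1 := by
    refine (congrArg (tau1 D ω) (grassD_five_conf l)).trans ?_
    simp only [map_sum, map_zsmul, h1]
  have h3 : bdry3 D (tau2 D ω (conf l)) = tau1 D ω (grassD F V 5 (conf l)) := by
    rw [h, h2, bdry3_tau2Val]
  rw [AddMonoidHom.comp_apply, AddMonoidHom.comp_apply, LinearMap.toAddMonoidHom_coe]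
  exact h3

end Square
end WeightThree
end

open WeightThree in
theorem mainTheorem3 {F : Type*} [Field F] [NeZero (2 : F)] [NeZero (3 : F)] [NeZero (5 : F)]
    (D : Derivation ℤ F F) {V : Type*} [AddCommGroup V] [Module F V]
    [Fact (Module.finrank F V = 3)] (ω : VolumeForm F V) :
    -- both rows are complexes
    (grassD F V 4).comp (grassD F V 5) = 0 ∧
    bdryMid D ∘ₗ bdry3 D = 0 ∧
    -- both squares commute
    (bdry3 D).toAddMonoidHom.comp (tau2 D ω) = (tau1 D ω).comp (grassD F V 5) ∧
    (bdryMid D).toAddMonoidHom.comp (tau1 D ω) = (tau0 D ω).comp (grassD F V 4) :=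
  ⟨grassD_comp_grassD F V, bdryMid_comp_bdry3 D, bdry3_comp_tau2 D ω, bdryMid_comp_tau1 D ω⟩
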